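/- Let $G$ be a finite, simple, connected graph with edges $e_1,\dots,e_m$, and let $K$ be any field. Let $\mathcal A_G=\{\mathbf a_1,\dots,\mathbf a_m\}\subset\mathbb Z^{V(G)}$, where $\mathbf a_i$ has entry $1$ at the two end points of $e_i$ and $0$ elsewhere, let $\ker_{\mathbb Z}(\mathcal A_G)=\{\mathbf u\in\mathbb Z^m : \sum_i u_i\mathbf a_i=\mathbf 0\}$, and let $$I_{\mathcal A_G}=\big(\mathbf x^{\mathbf u_+}-\mathbf x^{\mathbf u_-} : \mathbf u\in\ker_{\mathbb Z}(\mathcal A_G)\big)\subset K[x_1,\dots,x_m]$$ be the toric ideal of $G$, where $\mathbf u_+,\mathbf u_-$ are the positive and negative parts of $\mathbf u$. A binomial is a difference of two distinct monomials. We use the following notions. - A binomial is a *minimal binomial* of $I_{\mathcal A_G}$ if it belongs to some inclusion-minimal system of binomial generators of $I_{\mathcal A_G}$. A monomial $M$ is *indispensable* of $I_{\mathcal A_G}$ if every system of binomial generators of $I_{\mathcal A_G}$ contains a binomial in which $M$ occurs. - A *circuit* is a binomial $\mathbf x^{\mathbf u_+}-\mathbf x^{\mathbf u_-}$, where $\mathbf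 0\neq\mathbf u\in\ker_{\mathbb Z}(\mathcal A_G)$ has coprime coordinates and no nonzero $\mathbf v\in\ker_{\mathbb Z}(\mathcal A_G)$ has support strictly contained in the support of $\mathbf u$. - For an even closed walk $w=(e_{i_1},\dots,e_{i_{2s}})$ of $G$, put $B_w=B_w^{(+)}-B_w^{(-)}$ with $B_w^{(+)}=\prod_{k=1}^s x_{i_{2k-1}}$ and $B_w^{(-)}=\prod_{k=1}^s x_{i_{2k}}$. - $\mu(I_{\mathcal A_G})$ is the minimal number of generators of $I_{\mathcal A_G}$, i.e. the least cardinality of a system of binomial generators. $\mathrm{bar}(I_{\mathcal A_G})$ is the binomial arithmetical rank, i.e. the smallest $s$ for which there are binomials $B_1,\dots,B_s\in I_{\mathcal A_G}$ with $\mathrm{rad}(I_{\mathcal A_G})=\mathrm{rad}(B_1,\dots,B_s)$. Assume that $G$ satisfies $(\sharp)$ no induced subgraph of $G$ consists of two vertex-disjoint odd cycles joined by a path of length $\geq 1$ (the path meeting the two cycles only in its end points), and that there is no even closed walk $w$ of $G$ such that $B_w$ is both a minimal binomial of $I_{\mathcal A_G}$ and a circuit, and $B_w^{(+)}$ and $B_w^{(-)}$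 are both squarefree and both not indispensable of $I_{\mathcal A_G}$. Then $$\mathrm{bar}(I_{\mathcal A_G})=\mu(I_{\mathcal A_G}).$$ -/

import Mathlib

open scoped BigOperators

namespace ToricGraph

noncomputable section

/-! ### Binomials, generating systems, indispensable monomials -/

/-- A binomial: a difference of two (distinct) monomials, with coefficients `1` and `-1`. -/
def IsBinomial {σ K : Type*} [Field K] (f : MvPolynomial σ K) : Prop :=
  ∃ u v : σ →₀ ℕ, u ≠ v ∧ f = MvPolynomial.monomial u 1 - MvPolynomial.monomial v 1

/-- A system of binomial generators of the ideal `I`. -/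
def IsBinomialSystem {σ K : Type*} [Field K] (I : Ideal (MvPolynomial σ K))
    (S : Set (MvPolynomial σ K)) : Prop :=
  (∀ f ∈ S, IsBinomial f) ∧ Ideal.span S = I

/-- A minimal binomial of `I`: a member of some inclusion-minimal system of binomial
generators of `I`. -/
def IsMinimalBinomial {σ K : Type*} [Field K] (I : Ideal (MvPolynomial σ K))
    (f : MvPolynomial σ K) : Prop :=
  ∃ S : Set (MvPolynomial σ K), Minimal (IsBinomialSystem I) S ∧ f ∈ S

/-- The monomial with exponent vector `m` is indispensable of `I`: every system of binomial
generators of `I` contains a binomial in which this monomial occurs. -/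
def IsIndispensableMonomial {σ K : Type*} [Field K] (I : Ideal (MvPolynomial σ K))
    (m : σ →₀ ℕ) : Prop :=
  ∀ S : Set (MvPolynomial σ K), IsBinomialSystem I S → ∃ f ∈ S, m ∈ f.support

/-- The monomial with exponent vector `m` is squarefree. -/
def IsSquarefreeExp {σ : Type*} (m : σ →₀ ℕ) : Prop := ∀ i, m i ≤ 1

/-- The minimal number of generators: the least cardinality of a system of binomial
generators of `I`. -/
def mu {σ K : Type*} [Field K] (I : Ideal (MvPolynomial σ K)) : ℕ :=
  sInf {s : ℕ | ∃ S : Finset (MvPolynomial σ K),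
    IsBinomialSystem I (S : Set (MvPolynomial σ K)) ∧ S.card = s}

/-- The binomial arithmetical rank: the least `s` such that there are binomials
`B₁, …, Bₛ` in `I` with `rad I = rad (B₁, …, Bₛ)`. -/
def bar {σ K : Type*} [Field K] (I : Ideal (MvPolynomial σ K)) : ℕ :=
  sInf {s : ℕ | ∃ B : Fin s → MvPolynomial σ K,
    (∀ i, IsBinomial (B i) ∧ B i ∈ I) ∧ I.radical = (Ideal.span (Set.range B)).radical}

/-! ### Lattice ideals, toric ideals, circuits -/

/-- The positive part `u₊` of an integer vector, as an exponent vector. -/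
def posExp {σ : Type*} [Finite σ] (u : σ → ℤ) : σ →₀ ℕ :=
  Finsupp.equivFunOnFinite.symm fun i => (u i).toNat

/-- The negative part `u₋` of an integer vector, as an exponent vector. -/
def negExp {σ : Type*} [Finite σ] (u : σ → ℤ) : σ →₀ ℕ :=
  Finsupp.equivFunOnFinite.symm fun i => (-u i).toNat

/-- The polynomial `x^{u₊} - x^{u₋}`. -/
def vecBinomial {σ : Type*} [Finite σ] (K : Type*) [Field K] (u : σ → ℤ) :
    MvPolynomial σ K :=
  MvPolynomial.monomial (posExp u) 1 - MvPolynomial.monomial (negExp u) 1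

/-- The lattice ideal of a lattice `L` in `ℤ^σ`. -/
def latticeIdeal {σ : Type*} [Finite σ] (K : Type*) [Field K] (L : AddSubgroup (σ → ℤ)) :
    Ideal (MvPolynomial σ K) :=
  Ideal.span {f | ∃ u ∈ L, f = vecBinomial K u}

/-- The lattice of integer relations of a vector configuration `A`. -/
def kerZ {σ τ : Type*} [Fintype σ] (A : σ → τ → ℤ) : AddSubgroup (σ → ℤ) where
  carrier := {q | ∑ i, q i • A i = 0}
  zero_mem' := by simp
  add_mem' := by
    intro a b ha hb
    simp only [Set.mem_ofPred_eq, Pi.add_apply, add_smul, Finset.sum_add_distrib] at ha hb ⊢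
    rw [ha, hb, add_zero]
  neg_mem' := by
    intro a ha
    simp only [Set.mem_ofPred_eq, Pi.neg_apply, neg_smul, Finset.sum_neg_distrib] at ha ⊢
    rw [ha, neg_zero]

/-- The toric ideal of a vector configuration `A`. -/
def toricIdeal {σ τ : Type*} [Fintype σ] (K : Type*) [Field K] (A : σ → τ → ℤ) :
    Ideal (MvPolynomial σ K) :=
  latticeIdeal K (kerZ A)

/-- A circuit vector of `A`: a nonzero integer relation with coprime coordinates whose support
is minimal among the supports of the nonzero relations. -/
def IsCircuitVector {σ τ : Type*} [Fintype σ] (A : σ → τ → ℤ) (u : σ → ℤ) : Prop :=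
  u ∈ kerZ A ∧ u ≠ 0 ∧
    (∀ v ∈ kerZ A, v ≠ 0 → ¬ Function.support v ⊂ Function.support u) ∧
    Finset.univ.gcd u = 1

/-- A circuit (as a binomial) of the toric ideal of `A`. -/
def IsCircuit {σ τ K : Type*} [Fintype σ] [Field K] (A : σ → τ → ℤ)
    (f : MvPolynomial σ K) : Prop :=
  ∃ u : σ → ℤ, IsCircuitVector A u ∧ f = vecBinomial K u

/-! ### Graphs -/

/-- The vector configuration of a graph: the edge `{v, w}` gives the vector with entries `1`
at `v` and `w` and `0` elsewhere. -/
def edgeVectors {V : Type*} [DecidableEq V] (G : SimpleGraph V) : G.edgeSet → V → ℤ :=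
  fun e v => if v ∈ (e : Sym2 V) then 1 else 0

/-- The toric ideal of a graph, with one variable for each edge. -/
def graphIdeal {V : Type*} [Fintype V] [DecidableEq V] (K : Type*) [Field K]
    (G : SimpleGraph V) [DecidableRel G.Adj] : Ideal (MvPolynomial G.edgeSet K) :=
  toricIdeal K (edgeVectors G)

/-- For a walk `(e₁, e₂, …)`, the exponent vector of `x_{e₁} x_{e₃} x_{e₅} ⋯`
(list positions start at `0`). -/
def walkPlus {V : Type*} {G : SimpleGraph V} {a b : V} (w : G.Walk a b) : G.edgeSet →₀ ℕ :=
  ∑ i : Fin w.darts.length,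
    if Even (i : ℕ) then Finsupp.single ⟨(w.darts.get i).edge, (w.darts.get i).edge_mem⟩ 1 else 0

/-- For a walk `(e₁, e₂, …)`, the exponent vector of `x_{e₂} x_{e₄} x_{e₆} ⋯`. -/
def walkMinus {V : Type*} {G : SimpleGraph V} {a b : V} (w : G.Walk a b) : G.edgeSet →₀ ℕ :=
  ∑ i : Fin w.darts.length,
    if Odd (i : ℕ) then Finsupp.single ⟨(w.darts.get i).edge, (w.darts.get i).edge_mem⟩ 1 else 0

/-- The polynomial `B_w = B_w^{(+)} - B_w^{(-)}` (used for even closed walks `w`). -/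
def walkBinomial {V : Type*} {G : SimpleGraph V} (K : Type*) [Field K] {a b : V}
    (w : G.Walk a b) : MvPolynomial G.edgeSet K :=
  MvPolynomial.monomial (walkPlus w) 1 - MvPolynomial.monomial (walkMinus w) 1

/-- Condition (♯): no induced subgraph consists of two vertex-disjoint odd cycles
(`c₁` through `a`, `c₂` through `b`) joined by a path `p` of length at least `1` from `a` to `b`
that meets the two cycles only in its end points. That the subgraph is induced says that every
edge of the graph between its vertices is an edge of `c₁`, of `c₂` or of `p`. -/
def SatisfiesSharp {V : Type*} (G : SimpleGraph V) : Prop :=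
  ¬ ∃ (a b : V) (c₁ : G.Walk a a) (c₂ : G.Walk b b) (p : G.Walk a b),
    c₁.IsCycle ∧ Odd c₁.length ∧ c₂.IsCycle ∧ Odd c₂.length ∧ p.IsPath ∧ 1 ≤ p.length ∧
    (∀ x ∈ c₁.support, x ∉ c₂.support) ∧
    (∀ x ∈ p.support, x ∈ c₁.support → x = a) ∧
    (∀ x ∈ p.support, x ∈ c₂.support → x = b) ∧
    (∀ x y : V, (x ∈ c₁.support ∨ x ∈ c₂.support ∨ x ∈ p.support) →
      (y ∈ c₁.support ∨ y ∈ c₂.support ∨ y ∈ p.support) → G.Adj x y →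
      (s(x, y) ∈ c₁.edges ∨ s(x, y) ∈ c₂.edges ∨ s(x, y) ∈ p.edges))

end

end ToricGraph

/-!
The toric ideal of `G` is spanned by the differences of monomials with the same vertex degrees
(`endpoints`). Two monomials of one degree are linked if monomials of this degree, each having a
variable in common with the next, lead from one to the other; a minimal system of generators joins
the linkage classes of every degree by trees.

Under (♯) two unlinked monomials are the two sides of an even cycle or of two odd cycles with one
common vertex, which are circuits, so by hypothesis one side `M` of every minimal binomial is
isolated: squarefree, and disjoint from all other monomials of its degree. Evaluating at the
indicator vector of the support of `M` shows that binomials generating the ideal up to radical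
include one in which a monomial of the support of `M` occurs; its two monomials touch isolated
monomials of a single degree only, and at most two of these. As a degree with three unlinked
monomials consists of the three perfect matchings of a complete graph on four vertices, counting
over the degrees gives `μ ≤ bar`.
-/

namespace ToricGraph

open MvPolynomial
open SimpleGraph (Walk)

/-! ### Linked and isolated monomials -/

section Linked

variable {σ M : Type*} [AddCommMonoid M] {D : (σ →₀ ℕ) →+ M}

lemma exists_common_of_not_disjoint {m n : σ →₀ ℕ} (h : ¬ Disjoint m n) :
    ∃ g m' n', g ≠ 0 ∧ m = g + m' ∧ n = g + n' := by
  simp only [Disjoint, le_bot_iff, not_forall] at h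
  obtain ⟨g, hm, hn, hg⟩ := h
  obtain ⟨m', rfl⟩ := le_iff_exists_add.1 hm
  obtain ⟨n', rfl⟩ := le_iff_exists_add.1 hn
  exact ⟨g, m', n', hg, rfl, rfl⟩

lemma degree_lt_degree_add {m n : σ →₀ ℕ} (hn : n ≠ 0) : m.degree < (m + n).degree := by
  rw [map_add]
  exact Nat.lt_add_of_pos_right (Nat.pos_of_ne_zero (mt (Finsupp.degree_eq_zero_iff n).1 hn))

/-- Two monomials are linked for a grading `D` if monomials of their degree lead from one to the
other, consecutive ones having a common variable. -/
def Linked (D : (σ →₀ ℕ) →+ M) : (σ →₀ ℕ) → (σ →₀ ℕ) → Prop :=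
  Relation.ReflTransGen fun m n => D m = D n ∧ ¬ Disjoint m n

lemma Linked.refl (m : σ →₀ ℕ) : Linked D m m := Relation.ReflTransGen.refl

lemma Linked.symm {m n : σ →₀ ℕ} (h : Linked D m n) : Linked D n m := by
  induction h with
  | refl => exact .refl _
  | tail _ hstep ih => exact Relation.ReflTransGen.head ⟨hstep.1.symm, fun hd => hstep.2 hd.symm⟩ ih

lemma Linked.trans {m n k : σ →₀ ℕ} (h : Linked D m n) (h' : Linked D n k) : Linked D m k :=
  Relation.ReflTransGen.trans h h'

lemma Linked.map_eq {m n : σ →₀ ℕ} (h : Linked D m n) : D m = D n := by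
  induction h with
  | refl => rfl
  | tail _ hstep ih => exact ih.trans hstep.1

lemma disjoint_of_not_linked {m n : σ →₀ ℕ} (hD : D m = D n) (h : ¬ Linked D m n) :
    Disjoint m n :=
  not_not.1 fun hmn => h (.single ⟨hD, hmn⟩)

lemma Linked.of_le {m n g : σ →₀ ℕ} (hD : D m = D n) (hg : g ≠ 0) (hm : g ≤ m) (hn : g ≤ n) :
    Linked D m n :=
  .single ⟨hD, fun h => hg (le_bot_iff.1 (h hm hn))⟩

/-- Two monomials of one degree are split if they are exchanged in two steps, through a middle
monomial `g` which is trivial unless one of the exchanged parts has a variable of its own. -/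
def IsSplit (D : (σ →₀ ℕ) →+ M) (m n : σ →₀ ℕ) : Prop :=
  ∃ g m₁ m₂ n₁ n₂, m = m₁ + m₂ ∧ n = n₁ + n₂ ∧ D m₁ = D (n₁ + g) ∧ D (m₂ + g) = D n₂ ∧
    m₂ ≠ 0 ∧ n₁ ≠ 0 ∧ (g = 0 ∨ ¬ m₂.support ⊆ m₁.support ∨ ¬ n₁.support ⊆ n₂.support)

lemma IsSplit.symm {m n : σ →₀ ℕ} (h : IsSplit D m n) : IsSplit D n m := by
  obtain ⟨g, m₁, m₂, n₁, n₂, rfl, rfl, h₁, h₂, hm₂, hn₁, hg⟩ := h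
  exact ⟨g, n₂, n₁, m₂, m₁, add_comm _ _, add_comm _ _, h₂.symm, h₁.symm, hn₁, hm₂,
    hg.imp_right Or.symm⟩

lemma linked_of_exchange {g m₁ m₂ n₁ n₂ : σ →₀ ℕ} (h₁ : D m₁ = D (n₁ + g))
    (h₂ : D (m₂ + g) = D n₂) (hm₂ : m₂ ≠ 0) (hn₁ : n₁ ≠ 0) :
    Linked D (m₁ + m₂) (n₁ + n₂) := by
  have left : Linked D (m₁ + m₂) (n₁ + g + m₂) :=
    .of_le (by rw [map_add, h₁, ← map_add]) hm₂ le_add_self le_add_self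
  have right : Linked D (n₁ + g + m₂) (n₁ + n₂) :=
    .of_le (by rw [add_assoc, add_comm g, map_add, h₂, ← map_add]) hn₁
      (by rw [add_assoc]; exact le_self_add) le_self_add
  exact left.trans right

lemma IsSplit.linked {m n : σ →₀ ℕ} (h : IsSplit D m n) : Linked D m n := by
  obtain ⟨g, m₁, m₂, n₁, n₂, rfl, rfl, h₁, h₂, hm₂, hn₁, -⟩ := h
  exact linked_of_exchange h₁ h₂ hm₂ hn₁

/-- Three pairwise unlinked monomials of one degree. -/
structure IsUnlinkedTriple (D : (σ →₀ ℕ) →+ M) (x y z : σ →₀ ℕ) : Prop where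
  map_eq₁₂ : D x = D y
  map_eq₁₃ : D x = D z
  unlinked₁₂ : ¬ Linked D x y
  unlinked₁₃ : ¬ Linked D x z
  unlinked₂₃ : ¬ Linked D y z

lemma IsUnlinkedTriple.rotate {x y z : σ →₀ ℕ} (h : IsUnlinkedTriple D x y z) :
    IsUnlinkedTriple D y z x :=
  ⟨h.map_eq₁₂.symm.trans h.map_eq₁₃, h.map_eq₁₂.symm, h.unlinked₂₃, fun hl => h.unlinked₁₂ hl.symm,
    fun hl => h.unlinked₁₃ hl.symm⟩

lemma IsUnlinkedTriple.swap {x y z : σ →₀ ℕ} (h : IsUnlinkedTriple D x y z) :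
    IsUnlinkedTriple D y x z :=
  ⟨h.map_eq₁₂.symm, h.map_eq₁₂.symm.trans h.map_eq₁₃, fun hl => h.unlinked₁₂ hl.symm,
    h.unlinked₂₃, h.unlinked₁₃⟩

/-- Monomials of one degree for `D` have the same total degree. -/
def PreservesDegree (D : (σ →₀ ℕ) →+ M) : Prop :=
  ∀ ⦃m n : σ →₀ ℕ⦄, D m = D n → m.degree = n.degree

/-- Coprime monomials of one degree are split unless both are squarefree. -/
def SquarefreeOrSplit (D : (σ →₀ ℕ) →+ M) : Prop :=
  ∀ ⦃m n : σ →₀ ℕ⦄, D m = D n → m ≠ 0 → Disjoint m n →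
    (IsSquarefreeExp m ∧ IsSquarefreeExp n) ∨ IsSplit D m n

/-- Three pairwise unlinked monomials of one degree are the only monomials of that degree. -/
def UnlinkedTriplesExhaust (D : (σ →₀ ℕ) →+ M) : Prop :=
  ∀ ⦃x y z : σ →₀ ℕ⦄, IsUnlinkedTriple D x y z → ∀ t, D t = D x → t = x ∨ t = y ∨ t = z

lemma PreservesDegree.ne_zero (hdeg : PreservesDegree D) {m n : σ →₀ ℕ} (hD : D m = D n)
    (hne : m ≠ n) : m ≠ 0 := by
  rintro rfl
  exact hne ((Finsupp.degree_eq_zero_iff n).1 (by rw [← hdeg hD, map_zero])).symm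

lemma SquarefreeOrSplit.squarefree_of_not_linked (hsplit : SquarefreeOrSplit D) {m n : σ →₀ ℕ}
    (hD : D m = D n) (h : ¬ Linked D m n) : IsSquarefreeExp m := by
  rcases eq_or_ne m 0 with rfl | hm
  · exact fun _ => zero_le_one
  · exact ((hsplit hD hm (disjoint_of_not_linked hD h)).resolve_right fun hs => h hs.linked).1

end Linked

section Isolated

variable {σ M : Type*} [AddCommMonoid M] {D : (σ →₀ ℕ) →+ M}

/-- A squarefree monomial, not the only one of its degree, having no variable in common with the
other monomials of its degree. -/
structure IsIsolated (D : (σ →₀ ℕ) →+ M) (m : σ →₀ ℕ) : Prop where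
  squarefree : IsSquarefreeExp m
  disjoint : ∀ n, D n = D m → n ≠ m → Disjoint m n
  exists_ne : ∃ n, D n = D m ∧ n ≠ m

lemma IsUnlinkedTriple.isIsolated {x y z : σ →₀ ℕ} (h : IsUnlinkedTriple D x y z)
    (hsplit : SquarefreeOrSplit D) (htriple : UnlinkedTriplesExhaust D) : IsIsolated D x := by
  refine ⟨hsplit.squarefree_of_not_linked h.map_eq₁₂ h.unlinked₁₂, fun n hn hne => ?_, y,
    h.map_eq₁₂.symm, ?_⟩
  · rcases htriple h n hn with rfl | rfl | rfl
    · exact absurd rfl hne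
    · exact disjoint_of_not_linked h.map_eq₁₂ h.unlinked₁₂
    · exact disjoint_of_not_linked h.map_eq₁₃ h.unlinked₁₃
  · rintro rfl
    exact h.unlinked₁₂ (.refl _)

lemma IsSquarefreeExp.le_of_support_subset {m n : σ →₀ ℕ} (hm : IsSquarefreeExp m)
    (h : m.support ⊆ n.support) : m ≤ n := fun e => by
  by_cases he : m e = 0
  · simp only [he, zero_le]
  · have hn : n e ≠ 0 := Finsupp.mem_support_iff.1 (h (Finsupp.mem_support_iff.2 he))
    exact (hm e).trans (Nat.one_le_iff_ne_zero.2 hn)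

lemma IsIsolated.eq_of_support_eq {m n : σ →₀ ℕ} (hm : IsIsolated D m) (hn : IsIsolated D n)
    (h : m.support = n.support) : m = n :=
  le_antisymm (hm.squarefree.le_of_support_subset h.le) (hn.squarefree.le_of_support_subset h.ge)

lemma ne_add_of_disjoint {m₁ m₂ n₁ n₂ : σ →₀ ℕ} (h : Disjoint (m₁ + m₂) (n₁ + n₂))
    (hn₁ : n₁ ≠ 0) (g : σ →₀ ℕ) : m₁ ≠ n₁ + g := by
  rintro rfl
  exact hn₁ (le_bot_iff.1 (h (le_self_add.trans le_self_add) le_self_add))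

lemma IsIsolated.eq_of_le {m r b : σ →₀ ℕ} (hm : IsIsolated D m) (hr : r ≤ m) (hD : D r = D b)
    (hne : r ≠ b) : r = m := by
  obtain ⟨c, rfl⟩ := le_iff_exists_add'.1 hr
  have hdis := hm.disjoint (c + b) (by rw [map_add, map_add, hD]) (by simpa using hne.symm)
  rw [show c = 0 from le_bot_iff.1 (hdis le_self_add le_self_add), zero_add]

variable [IsLeftCancelAdd M]

lemma IsIsolated.le_of_support_subset (hdeg : PreservesDegree D) (hsplit : SquarefreeOrSplit D)
    {m r b : σ →₀ ℕ} (hm : IsIsolated D m) (hD : D r = D b) (hne : r ≠ b)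
    (hr : r.support ⊆ m.support) : m ≤ r := by
  induction hn : r.degree using Nat.strong_induction_on generalizing r b with
  | _ n ih =>
    subst hn
    have descend : ∀ {r₁ r₂ b₁ : σ →₀ ℕ}, r = r₁ + r₂ → r₂ ≠ 0 → D r₁ = D b₁ → r₁ ≠ b₁ →
        m ≤ r := by
      rintro r₁ r₂ b₁ rfl hr₂ hD₁ hne₁
      exact (ih _ (degree_lt_degree_add hr₂) hD₁ hne₁
        ((Finsupp.support_mono le_self_add).trans hr) rfl).trans le_self_add
    by_cases hdis : Disjoint r b
    · rcases hsplit hD (hdeg.ne_zero hD hne) hdis with ⟨hsq, -⟩ | hsplit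
      · exact (hm.eq_of_le (hsq.le_of_support_subset hr) hD hne).ge
      · obtain ⟨g, r₁, r₂, b₁, b₂, rfl, rfl, hD₁, -, hr₂, hb₁, -⟩ := hsplit
        exact descend rfl hr₂ hD₁ (ne_add_of_disjoint hdis hb₁ g)
    · obtain ⟨g, r', b', hg, rfl, rfl⟩ := exists_common_of_not_disjoint hdis
      exact descend (add_comm g r') hg (by simpa using hD) (by rintro rfl; exact hne rfl)

lemma IsIsolated.map_eq_of_support_subset (hdeg : PreservesDegree D) (hsplit : SquarefreeOrSplit D)
    {m m' r b : σ →₀ ℕ} (hm : IsIsolated D m) (hm' : IsIsolated D m') (hD : D r = D b)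
    (hne : r ≠ b) (hr : r.support ⊆ m.support) (hb : b.support ⊆ m'.support) : D m = D m' := by
  induction hn : r.degree using Nat.strong_induction_on generalizing r b with
  | _ n ih =>
    subst hn
    have descend : ∀ {r₁ r₂ b₁ b₂ : σ →₀ ℕ}, r = r₁ + r₂ → b = b₁ + b₂ → r₂ ≠ 0 → D r₁ = D b₁ →
        r₁ ≠ b₁ → D m = D m' := by
      rintro r₁ r₂ b₁ b₂ rfl rfl hr₂ hD₁ hne₁
      exact ih _ (degree_lt_degree_add hr₂) hD₁ hne₁
        ((Finsupp.support_mono le_self_add).trans hr)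
        ((Finsupp.support_mono le_self_add).trans hb) rfl
    by_cases hdis : Disjoint r b
    · rcases hsplit hD (hdeg.ne_zero hD hne) hdis with ⟨hsqr, hsqb⟩ | hrb
      · rw [← hm.eq_of_le (hsqr.le_of_support_subset hr) hD hne,
          ← hm'.eq_of_le (hsqb.le_of_support_subset hb) hD.symm hne.symm, hD]
      · obtain ⟨g, r₁, r₂, b₁, b₂, rfl, rfl, hD₁, hD₂, hr₂, hb₁, hg⟩ := hrb
        have hne₁ : r₁ ≠ b₁ + g := ne_add_of_disjoint hdis hb₁ g
        have hne₂ : b₂ ≠ r₂ + g :=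
          ne_add_of_disjoint (add_comm b₁ b₂ ▸ add_comm r₁ r₂ ▸ hdis.symm) hr₂ g
        have hmr : m ≤ r₁ := hm.le_of_support_subset hdeg hsplit hD₁ hne₁
          ((Finsupp.support_mono le_self_add).trans hr)
        have hmb : m' ≤ b₂ := hm'.le_of_support_subset hdeg hsplit hD₂.symm hne₂
          ((Finsupp.support_mono le_add_self).trans hb)
        rcases hg with rfl | hg | hg
        · exact descend rfl rfl hr₂ (by simpa using hD₁) (by simpa using hne₁)
        · exact absurd (((Finsupp.support_mono le_add_self).trans hr).trans
            (Finsupp.support_mono hmr)) hg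
        · exact absurd (((Finsupp.support_mono le_self_add).trans hb).trans
            (Finsupp.support_mono hmb)) hg
    · obtain ⟨g, r', b', hg, rfl, rfl⟩ := exists_common_of_not_disjoint hdis
      exact descend (add_comm g r') (add_comm g b') hg (by simpa using hD)
        (by rintro rfl; exact hne rfl)

end Isolated

section Touches

variable {σ M : Type*} [AddCommMonoid M] {D : (σ →₀ ℕ) →+ M}

/-- One of the monomials `u`, `v` involves only variables of `m`. -/
def Touches (u v m : σ →₀ ℕ) : Prop :=
  u.support ⊆ m.support ∨ v.support ⊆ m.support

variable [IsLeftCancelAdd M] (hdeg : PreservesDegree D) (hsplit : SquarefreeOrSplit D)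
  {u v m m' : σ →₀ ℕ} (hD : D u = D v) (hne : u ≠ v) (hm : IsIsolated D m)
  (hm' : IsIsolated D m')

include hdeg hsplit hD hne hm

lemma Touches.support_eq (h : Touches u v m) : m.support = u.support ∨ m.support = v.support :=
  h.imp
    (fun h => (Finsupp.support_mono (hm.le_of_support_subset hdeg hsplit hD hne h)).antisymm h)
    fun h => (Finsupp.support_mono
      (hm.le_of_support_subset hdeg hsplit hD.symm hne.symm h)).antisymm h

include hm'

lemma Touches.map_eq (h : Touches u v m) (h' : Touches u v m') : D m = D m' := by
  rcases h.support_eq hdeg hsplit hD hne hm with hs | hs <;>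
    rcases h'.support_eq hdeg hsplit hD hne hm' with hs' | hs'
  · rw [hm.eq_of_support_eq hm' (hs.trans hs'.symm)]
  · exact hm.map_eq_of_support_subset hdeg hsplit hm' hD hne hs.ge hs'.ge
  · exact hm.map_eq_of_support_subset hdeg hsplit hm' hD.symm hne.symm hs.ge hs'.ge
  · rw [hm.eq_of_support_eq hm' (hs.trans hs'.symm)]

lemma Touches.eq_or_eq_or_eq {m'' : σ →₀ ℕ} (hm'' : IsIsolated D m'') (h : Touches u v m)
    (h' : Touches u v m') (h'' : Touches u v m'') : m = m' ∨ m = m'' ∨ m' = m'' := by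
  have hs := h.support_eq hdeg hsplit hD hne hm
  have hs' := h'.support_eq hdeg hsplit hD hne hm'
  have hs'' := h''.support_eq hdeg hsplit hD hne hm''
  have pigeonhole : m.support = m'.support ∨ m.support = m''.support ∨
      m'.support = m''.support := by grind
  exact pigeonhole.imp (hm.eq_of_support_eq hm')
    (Or.imp (hm.eq_of_support_eq hm'') (hm'.eq_of_support_eq hm''))

end Touches

/-! ### Binomial generators and radicals -/

section Binomial

variable {σ K : Type*} [Field K]

variable (K) in
/-- The binomial with exponent vectors `u` and `v`, which is zero if `u = v`. -/
noncomputable def binomial (u v : σ →₀ ℕ) : MvPolynomial σ K := monomial u 1 - monomial v 1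

lemma mk_monomial_eq_iff {J : Ideal (MvPolynomial σ K)} {u v : σ →₀ ℕ} :
    Ideal.Quotient.mk J (monomial u 1) = Ideal.Quotient.mk J (monomial v 1) ↔
      binomial K u v ∈ J :=
  Ideal.Quotient.eq

lemma binomial_add_add (g u v : σ →₀ ℕ) :
    binomial K (g + u) (g + v) = monomial g 1 * binomial K u v := by
  simp only [binomial, mul_sub, monomial_mul, one_mul]

lemma mem_support_binomial {u v m : σ →₀ ℕ} (h : u ≠ v) :
    m ∈ (binomial K u v).support ↔ m = u ∨ m = v := by
  classical
  rw [binomial, mem_support_iff, coeff_sub, coeff_monomial, coeff_monomial]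
  grind

lemma span_image_isHomogeneous {ι : Type*} {f : ι → MvPolynomial σ K} {d : ι → ℕ}
    (hf : ∀ i, (f i).IsHomogeneous (d i)) {p : MvPolynomial σ K} {n : ℕ} (hp : p.IsHomogeneous n)
    (hmem : p ∈ Ideal.span (Set.range f)) : p ∈ Ideal.span (f '' {i | d i ≤ n}) := by
  obtain ⟨c, rfl⟩ := (Finsupp.mem_ideal_span_range_iff_exists_finsupp).1 hmem
  rw [← homogeneousComponent_eq_self hp, Finsupp.sum, map_sum]
  refine Submodule.sum_mem _ fun i _ => ?_
  rw [(c i).as_sum, Finset.sum_mul, map_sum]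
  refine Submodule.sum_mem _ fun u _ => ?_
  have hterm : (monomial u (coeff u (c i)) * f i).IsHomogeneous (u.degree + d i) :=
    (isHomogeneous_monomial _ rfl).mul (hf i)
  rw [homogeneousComponent_of_mem hterm]
  split_ifs with hn
  · exact Ideal.mul_mem_left _ _ (Ideal.subset_span ⟨i, hn ▸ Nat.le_add_left _ _, rfl⟩)
  · exact Submodule.zero_mem _

end Binomial

section Radical

variable {σ K : Type*} [Field K]

lemma eval_indicator_monomial [DecidableEq σ] (S : Finset σ) (u : σ →₀ ℕ) :
    eval ((S : Set σ).indicator 1) (monomial u (1 : K)) = if u.support ⊆ S then 1 else 0 := by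
  rw [eval_monomial, one_mul, Finsupp.prod]
  split_ifs with h
  · exact Finset.prod_eq_one fun e he => by
      rw [Set.indicator_of_mem (h he), Pi.one_apply, one_pow]
  · obtain ⟨e, he, heS⟩ := Finset.not_subset.1 h
    refine Finset.prod_eq_zero he ?_
    rw [Set.indicator_of_notMem heS, zero_pow (Finsupp.mem_support_iff.1 he)]

lemma exists_touches_of_radical_eq {κ : Type*} {I : Ideal (MvPolynomial σ K)}
    {u v : κ → σ →₀ ℕ}
    (hrad : I.radical = (Ideal.span (Set.range fun k => binomial K (u k) (v k))).radical)
    {m n : σ →₀ ℕ} (hmem : binomial K m n ∈ I) (hn : ¬ n.support ⊆ m.support) :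
    ∃ k, Touches (u k) (v k) m := by
  classical
  by_contra! hcon
  simp only [Touches, not_or] at hcon
  -- The family vanishes at the indicator vector of the support of `m`, where `binomial K m n` is 1.
  set φ := eval ((m.support : Set σ).indicator (1 : σ → K)) with hφ
  have eval_binomial (a b : σ →₀ ℕ) : φ (binomial K a b) =
      (if a.support ⊆ m.support then 1 else 0) - if b.support ⊆ m.support then 1 else 0 := by
    simp only [binomial, map_sub, hφ, eval_indicator_monomial]
  have vanish : Ideal.span (Set.range fun k => binomial K (u k) (v k)) ≤ RingHom.ker φ := by
    rw [Ideal.span_le]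
    rintro _ ⟨k, rfl⟩
    rw [SetLike.mem_coe, RingHom.mem_ker, eval_binomial, if_neg (hcon k).1, if_neg (hcon k).2,
      sub_zero]
  have hker : binomial K m n ∈ RingHom.ker φ := by
    have := Ideal.radical_mono vanish (hrad ▸ Ideal.le_radical hmem)
    rwa [(RingHom.ker_isPrime φ).radical] at this
  rw [RingHom.mem_ker, eval_binomial, if_pos subset_rfl, if_neg hn, sub_zero] at hker
  exact one_ne_zero hker

end Radical

section MinimalFamily

variable {σ K : Type*} [Field K] {I : Ideal (MvPolynomial σ K)}

lemma mu_le_card {ι : Type*} [Fintype ι] {M N : ι → σ →₀ ℕ} (hne : ∀ i, M i ≠ N i)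
    (hspan : Ideal.span (Set.range fun i => binomial K (M i) (N i)) = I) :
    mu I ≤ Fintype.card ι := by
  classical
  set S := Finset.univ.image fun i => binomial K (M i) (N i) with hS
  have hcoe : (S : Set (MvPolynomial σ K)) = Set.range fun i => binomial K (M i) (N i) := by
    rw [hS, Finset.coe_image, Finset.coe_univ, Set.image_univ]
  have hsys : IsBinomialSystem I (S : Set (MvPolynomial σ K)) := by
    rw [hcoe]
    exact ⟨Set.forall_mem_range.2 fun i => ⟨_, _, hne i, rfl⟩, hspan⟩
  have hmu : mu I ≤ S.card := Nat.sInf_le ⟨S, hsys, rfl⟩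
  exact hmu.trans Finset.card_image_le

lemma exists_family_card_eq_mu [Finite σ] (hI : ∃ S, IsBinomialSystem I S) :
    ∃ M N : Fin (mu I) → σ →₀ ℕ, (∀ i, M i ≠ N i) ∧
      Ideal.span (Set.range fun i => binomial K (M i) (N i)) = I := by
  obtain ⟨S, hS⟩ := hI
  obtain ⟨T, hTS, hT⟩ := (Submodule.fg_span_iff_fg_span_finset_subset S).1
    (IsNoetherian.noetherian (Submodule.span (MvPolynomial σ K) S))
  obtain ⟨T, hT, hcard⟩ := Nat.sInf_mem (s := {s | ∃ T : Finset (MvPolynomial σ K),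
    IsBinomialSystem I (T : Set (MvPolynomial σ K)) ∧ T.card = s})
    ⟨_, T, ⟨fun f hf => hS.1 f (hTS hf), hT.symm.trans hS.2⟩, rfl⟩
  have e : Fin (mu I) ≃ T := (T.equivFinOfCardEq hcard).symm
  choose M N hne heq using fun i => hT.1 (e i) (e i).2
  refine ⟨M, N, hne, ?_⟩
  rw [show (fun i => binomial K (M i) (N i)) = Subtype.val ∘ e from funext fun i => (heq i).symm,
    e.surjective.range_comp, Subtype.range_coe]
  exact hT.2

/-- A family of binomials generating `I` irredundantly, given by the exponent vectors of their two
monomials. -/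
structure IsMinimalFamily {ι : Type*} (I : Ideal (MvPolynomial σ K)) (M N : ι → σ →₀ ℕ) :
    Prop where
  ne (i : ι) : M i ≠ N i
  span_eq : Ideal.span (Set.range fun i => binomial K (M i) (N i)) = I
  notMem (i : ι) : binomial K (M i) (N i) ∉ Ideal.span ((fun j => binomial K (M j) (N j)) '' {i}ᶜ)

lemma exists_isMinimalFamily [Finite σ] (hI : ∃ S, IsBinomialSystem I S) :
    ∃ M N : Fin (mu I) → σ →₀ ℕ, IsMinimalFamily I M N := by
  obtain ⟨M, N, hne, hspan⟩ := exists_family_card_eq_mu hI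
  refine ⟨M, N, hne, hspan, fun i hi => ?_⟩
  set b := fun j => binomial K (M j) (N j)
  have hspan' : Ideal.span (Set.range fun j : ({i}ᶜ : Set (Fin (mu I))) => b j) = I := by
    rw [← Set.image_eq_range]
    refine ((Ideal.span_mono (Set.image_subset_range _ _)).trans hspan.le).antisymm
      (hspan.ge.trans (Ideal.span_le.2 ?_))
    rintro _ ⟨j, rfl⟩
    rcases eq_or_ne j i with rfl | hj
    · exact hi
    · exact Ideal.subset_span ⟨j, hj, rfl⟩
  have hle := mu_le_card (fun j : ({i}ᶜ : Set (Fin (mu I))) => hne j) hspan'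
  rw [Fintype.card_compl_set, Fintype.card_fin, Fintype.card_unique] at hle
  have := i.pos
  omega

lemma exists_radical_span_eq_of_mu [Finite σ] (hI : ∃ S, IsBinomialSystem I S) :
    ∃ B : Fin (mu I) → MvPolynomial σ K, (∀ i, IsBinomial (B i) ∧ B i ∈ I) ∧
      I.radical = (Ideal.span (Set.range B)).radical := by
  obtain ⟨M, N, hne, hspan⟩ := exists_family_card_eq_mu hI
  refine ⟨fun i => binomial K (M i) (N i), fun i => ⟨⟨_, _, hne i, rfl⟩, ?_⟩, by rw [hspan]⟩
  exact hspan.le (Ideal.subset_span ⟨i, rfl⟩)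

lemma bar_le_mu [Finite σ] (hI : ∃ S, IsBinomialSystem I S) : bar I ≤ mu I :=
  Nat.sInf_le (exists_radical_span_eq_of_mu hI)

lemma exists_radical_span_eq_of_bar [Finite σ] (hI : ∃ S, IsBinomialSystem I S) :
    ∃ B : Fin (bar I) → MvPolynomial σ K, (∀ i, IsBinomial (B i) ∧ B i ∈ I) ∧
      I.radical = (Ideal.span (Set.range B)).radical :=
  Nat.sInf_mem (s := {s | ∃ B : Fin s → MvPolynomial σ K, (∀ i, IsBinomial (B i) ∧ B i ∈ I) ∧
    I.radical = (Ideal.span (Set.range B)).radical}) ⟨_, exists_radical_span_eq_of_mu hI⟩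

namespace IsMinimalFamily

variable {ι : Type*} {M N : ι → σ →₀ ℕ}

lemma mem (h : IsMinimalFamily I M N) (i : ι) : binomial K (M i) (N i) ∈ I :=
  h.span_eq.le (Ideal.subset_span ⟨i, rfl⟩)

lemma isMinimalBinomial (h : IsMinimalFamily I M N) (i : ι) :
    IsMinimalBinomial I (binomial K (M i) (N i)) := by
  refine ⟨Set.range fun j => binomial K (M j) (N j), ⟨⟨?_, h.span_eq⟩, fun T hT hTS => ?_⟩, i, rfl⟩
  · rintro _ ⟨j, rfl⟩
    exact ⟨_, _, h.ne j, rfl⟩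
  · rintro _ ⟨j, rfl⟩
    by_contra hj
    refine h.notMem j (Ideal.span_mono ?_ (hT.2.ge (h.mem j)))
    intro f hf
    obtain ⟨k, rfl⟩ := hTS hf
    exact ⟨k, by rintro rfl; exact hj hf, rfl⟩

end IsMinimalFamily

end MinimalFamily

section FiberIdeal

variable {σ K M : Type*} [Field K] [AddCommMonoid M] {D : (σ →₀ ℕ) →+ M}

variable (K) in
/-- The ideal generated by the differences of monomials of the same degree for `D`. -/
noncomputable def fiberIdeal (D : (σ →₀ ℕ) →+ M) : Ideal (MvPolynomial σ K) :=
  Ideal.span {f | ∃ m n, D m = D n ∧ f = binomial K m n}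

lemma binomial_mem_fiberIdeal {m n : σ →₀ ℕ} : binomial K m n ∈ fiberIdeal K D ↔ D m = D n := by
  refine ⟨fun h => ?_, fun h => Ideal.subset_span ⟨m, n, h, rfl⟩⟩
  let φ := AddMonoidAlgebra.mapDomainRingHom K D
  have map_monomial (k : σ →₀ ℕ) : φ (monomial k 1) = .single (D k) 1 :=
    AddMonoidAlgebra.mapDomain_single
  have hker : fiberIdeal K D ≤ RingHom.ker φ := by
    refine Ideal.span_le.2 ?_
    rintro _ ⟨m, n, hD, rfl⟩
    rw [SetLike.mem_coe, RingHom.mem_ker, binomial, map_sub, map_monomial, map_monomial, hD,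
      sub_self]
  have hmap : φ (binomial K m n) = 0 := hker h
  rw [binomial, map_sub, map_monomial, map_monomial, sub_eq_zero] at hmap
  exact AddMonoidAlgebra.single_left_injective one_ne_zero hmap

lemma fiberIdeal_le {J : Ideal (MvPolynomial σ K)}
    (h : ∀ m n, m ≠ n → D m = D n → binomial K m n ∈ J) : fiberIdeal K D ≤ J := by
  refine Ideal.span_le.2 ?_
  rintro _ ⟨m, n, hD, rfl⟩
  by_cases hmn : m = n
  · rw [hmn, binomial, sub_self]
    exact J.zero_mem
  · exact h m n hmn hD

lemma fiberIdeal_congr {N : Type*} [AddCommMonoid N] {E : (σ →₀ ℕ) →+ N}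
    (h : ∀ m n, D m = D n ↔ E m = E n) : fiberIdeal K D = fiberIdeal K E := by
  simp only [fiberIdeal, h]

variable (K D) in
lemma exists_isBinomialSystem_fiberIdeal : ∃ S, IsBinomialSystem (fiberIdeal K D) S :=
  ⟨{f | IsBinomial f ∧ f ∈ fiberIdeal K D}, fun _ hf => hf.1,
    (Ideal.span_le.2 fun _ hf => hf.2).antisymm (fiberIdeal_le fun m n hmn hD =>
      Ideal.subset_span ⟨⟨m, n, hmn, rfl⟩, binomial_mem_fiberIdeal.2 hD⟩)⟩

lemma PreservesDegree.isHomogeneous_binomial (hdeg : PreservesDegree D) {m n : σ →₀ ℕ}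
    (hD : D m = D n) : (binomial K m n).IsHomogeneous m.degree :=
  (isHomogeneous_monomial _ rfl).sub (isHomogeneous_monomial _ (hdeg hD).symm)

variable [IsLeftCancelAdd M]

lemma disjoint_of_isIndispensableMonomial (hdeg : PreservesDegree D) {m n : σ →₀ ℕ}
    (hm : IsIndispensableMonomial (fiberIdeal K D) m) (hD : D n = D m) (hne : n ≠ m) :
    Disjoint m n := by
  by_contra hdis
  obtain ⟨g, m', n', hg, rfl, rfl⟩ := exists_common_of_not_disjoint hdis
  -- The binomials avoiding the monomial `g + m'` generate, since it is congruent to `g + n'`.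
  set S : Set (MvPolynomial σ K) :=
    {f | IsBinomial f ∧ f ∈ fiberIdeal K D ∧ g + m' ∉ f.support}
  set φ : (σ →₀ ℕ) → MvPolynomial σ K ⧸ Ideal.span S :=
    fun k => Ideal.Quotient.mk (Ideal.span S) (monomial k 1)
  have avoiding {a b : σ →₀ ℕ} (hab : D a = D b) (ha : a ≠ g + m') (hb : b ≠ g + m') :
      φ a = φ b := by
    by_cases hne : a = b
    · rw [hne]
    · refine mk_monomial_eq_iff.2 (Ideal.subset_span
        ⟨⟨a, b, hne, rfl⟩, binomial_mem_fiberIdeal.2 hab, ?_⟩)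
      rw [mem_support_binomial hne]
      exact fun h => h.elim (ha ·.symm) (hb ·.symm)
  have hD' : D n' = D m' := by simpa using hD
  have ne_of_degree {k : σ →₀ ℕ} (hk : k.degree = m'.degree) : k ≠ g + m' := by
    rintro rfl
    rw [add_comm] at hk
    exact (degree_lt_degree_add hg).ne hk.symm
  have exchange : φ (g + n') = φ (g + m') := by
    refine mk_monomial_eq_iff.2 ?_
    rw [binomial_add_add]
    exact Ideal.mul_mem_left _ _
      (mk_monomial_eq_iff.1 (avoiding hD' (ne_of_degree (hdeg hD')) (ne_of_degree rfl)))
  have hsys : IsBinomialSystem (fiberIdeal K D) S := by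
    refine ⟨fun f hf => hf.1, (Ideal.span_le.2 fun f hf => hf.2.1).antisymm
      (fiberIdeal_le fun a b hab hDab => mk_monomial_eq_iff.1 ?_)⟩
    by_cases ha : a = g + m'
    · subst ha
      exact exchange.symm.trans (avoiding (hD.trans hDab) hne hab.symm)
    · by_cases hb : b = g + m'
      · subst hb
        exact (avoiding (hDab.trans hD.symm) hab hne).trans exchange
      · exact avoiding hDab ha hb
  obtain ⟨f, hf, hmf⟩ := hm S hsys
  exact hf.2.2 hmf

lemma IsIndispensableMonomial.isIsolated (hdeg : PreservesDegree D) {m n : σ →₀ ℕ}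
    (hm : IsIndispensableMonomial (fiberIdeal K D) m) (hsq : IsSquarefreeExp m)
    (hD : D n = D m) (hne : n ≠ m) : IsIsolated D m :=
  ⟨hsq, fun _ hk hkm => disjoint_of_isIndispensableMonomial hdeg hm hk hkm, n, hD, hne⟩

end FiberIdeal

namespace IsMinimalFamily

variable {σ K M ι : Type*} [Field K] [AddCommMonoid M] [IsLeftCancelAdd M] {D : (σ →₀ ℕ) →+ M}
  {P Q : ι → σ →₀ ℕ} (h : IsMinimalFamily (fiberIdeal K D) P Q) (hdeg : PreservesDegree D)

include h

omit [IsLeftCancelAdd M] in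
lemma map_eq (i : ι) : D (P i) = D (Q i) := binomial_mem_fiberIdeal.1 (h.mem i)

include hdeg

-- A common variable can be cancelled, which lowers the degree.
lemma binomial_mem_span_of_linked {m n : σ →₀ ℕ} (hmn : Linked D m n) :
    binomial K m n ∈
      Ideal.span ((fun i => binomial K (P i) (Q i)) '' {i | (P i).degree < m.degree}) := by
  rw [← mk_monomial_eq_iff]
  induction hmn with
  | refl => rfl
  | @tail a b hma hab ih =>
    refine ih.trans (mk_monomial_eq_iff.2 ?_)
    have hDm : D m = D a := Linked.map_eq (D := D) hma
    rw [hdeg hDm]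
    obtain ⟨hD, hdis⟩ := hab
    obtain ⟨g, a', b', hg, rfl, rfl⟩ := exists_common_of_not_disjoint hdis
    rw [binomial_add_add]
    refine Ideal.mul_mem_left _ _ ?_
    have hD' : D a' = D b' := by simpa using hD
    have hlow := span_image_isHomogeneous (fun i => hdeg.isHomogeneous_binomial (h.map_eq i))
      (hdeg.isHomogeneous_binomial hD') (h.span_eq.ge (binomial_mem_fiberIdeal.2 hD'))
    refine Ideal.span_mono (Set.image_mono fun i (hi : (P i).degree ≤ a'.degree) => ?_) hlow
    rw [Set.mem_ofPred_eq, add_comm]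
    exact hi.trans_lt (degree_lt_degree_add hg)

lemma mk_eq_of_linked {i : ι} {m n : σ →₀ ℕ} (hmn : Linked D m n) (hm : D m = D (P i)) :
    Ideal.Quotient.mk (Ideal.span ((fun j => binomial K (P j) (Q j)) '' {i}ᶜ)) (monomial m 1) =
      Ideal.Quotient.mk _ (monomial n 1) := by
  refine mk_monomial_eq_iff.2
    (Ideal.span_mono (Set.image_mono ?_) (h.binomial_mem_span_of_linked hdeg hmn))
  rintro j (hj : (P j).degree < m.degree) (rfl : j = i)
  exact hj.ne (hdeg hm).symm

lemma not_linked (i : ι) : ¬ Linked D (P i) (Q i) :=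
  fun hl => h.notMem i (mk_monomial_eq_iff.1 (h.mk_eq_of_linked hdeg hl rfl))

-- If both monomials of the `j`-th binomial were linked to monomials of the `i`-th one, then the
-- `j`-th binomial would be generated by the other ones.
lemma exists_isUnlinkedTriple {i j : ι} (hij : i ≠ j) (hD : D (P i) = D (P j)) :
    IsUnlinkedTriple D (P i) (Q i) (P j) ∨ IsUnlinkedTriple D (P i) (Q i) (Q j) := by
  by_contra! hcon
  have linked {x : σ →₀ ℕ} (hx : D (P i) = D x) (hcon : ¬ IsUnlinkedTriple D (P i) (Q i) x) :
      Linked D (P i) x ∨ Linked D (Q i) x := by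
    by_contra! hl
    exact hcon ⟨h.map_eq i, hx, h.not_linked hdeg i, hl.1, hl.2⟩
  set φ := fun m : σ →₀ ℕ => Ideal.Quotient.mk
    (Ideal.span ((fun k => binomial K (P k) (Q k)) '' {j}ᶜ)) (monomial m 1)
  have hi : φ (P i) = φ (Q i) := mk_monomial_eq_iff.2 (Ideal.subset_span ⟨i, hij, rfl⟩)
  have eq_of_linked {x : σ →₀ ℕ} (hx : Linked D (P i) x ∨ Linked D (Q i) x) : φ (P i) = φ x :=
    hx.elim (h.mk_eq_of_linked hdeg · hD) fun hx =>
      hi.trans (h.mk_eq_of_linked hdeg hx ((h.map_eq i).symm.trans hD))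
  refine h.notMem j (mk_monomial_eq_iff.1 ?_)
  exact (eq_of_linked (linked hD hcon.1)).symm.trans
    (eq_of_linked (linked (hD.trans (h.map_eq j)) hcon.2))

lemma not_three (htriple : UnlinkedTriplesExhaust D) {i j k : ι} (hij : i ≠ j) (hik : i ≠ k)
    (hjk : j ≠ k) (hDj : D (P i) = D (P j)) (hDk : D (P i) = D (P k)) : False := by
  set φ := fun m : σ →₀ ℕ => Ideal.Quotient.mk
    (Ideal.span ((fun l => binomial K (P l) (Q l)) '' {k}ᶜ)) (monomial m 1)
  have hi : φ (P i) = φ (Q i) := mk_monomial_eq_iff.2 (Ideal.subset_span ⟨i, hik, rfl⟩)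
  have hj : φ (P j) = φ (Q j) := mk_monomial_eq_iff.2 (Ideal.subset_span ⟨j, hjk, rfl⟩)
  have constant : ∀ x, D x = D (P i) → φ x = φ (P i) := by
    have hQ : D (Q j) = D (P i) := (h.map_eq j).symm.trans hDj.symm
    have hne := h.ne j
    intro x hx
    rcases h.exists_isUnlinkedTriple hdeg hij hDj with ht | ht
    · have := htriple ht x hx
      have := htriple ht _ hQ
      grind
    · have := htriple ht x hx
      have := htriple ht _ hDj.symm
      grind
  exact h.notMem k (mk_monomial_eq_iff.1
    ((constant _ hDk.symm).trans (constant _ (hDk.trans (h.map_eq k)).symm).symm))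

end IsMinimalFamily

section Counting

lemma card_le_card_of_disjoint_of_card_fiber_le {ι κ M : Type*} [Fintype ι] [Fintype κ]
    [DecidableEq M] (d : ι → M) {T : M → Finset κ} (hT : Pairwise fun b b' => Disjoint (T b) (T b'))
    (hfiber : ∀ i, (Finset.univ.filter fun j => d j = d i).card ≤ (T (d i)).card) :
    Fintype.card ι ≤ Fintype.card κ := by
  classical
  calc Fintype.card ι
      = ∑ b ∈ Finset.univ.image d, (Finset.univ.filter fun j => d j = b).card :=
        Finset.card_eq_sum_card_image d _
    _ ≤ ∑ b ∈ Finset.univ.image d, (T b).card := Finset.sum_le_sum fun b hb => by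
        obtain ⟨i, -, rfl⟩ := Finset.mem_image.1 hb
        exact hfiber i
    _ = ((Finset.univ.image d).biUnion T).card :=
        (Finset.card_biUnion fun _ _ _ _ hne => hT hne).symm
    _ ≤ Fintype.card κ := Finset.card_le_univ _

variable {σ K M κ : Type*} [Field K] [AddCommMonoid M] {D : (σ →₀ ℕ) →+ M}
  {u v : κ → σ →₀ ℕ}

lemma IsIsolated.exists_touches (hdeg : PreservesDegree D)
    (hrad : (fiberIdeal K D).radical =
      (Ideal.span (Set.range fun k => binomial K (u k) (v k))).radical)
    {m : σ →₀ ℕ} (hm : IsIsolated D m) : ∃ k, Touches (u k) (v k) m := by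
  obtain ⟨n, hD, hne⟩ := hm.exists_ne
  refine exists_touches_of_radical_eq hrad (binomial_mem_fiberIdeal.2 hD.symm) fun hsub => ?_
  have hdis : Disjoint m.support n.support := Finsupp.disjoint_iff.1 (hm.disjoint n hD hne)
  exact hdeg.ne_zero hD hne (Finsupp.support_eq_empty.1 (disjoint_self.1 (hdis.mono_left hsub)))

variable [Fintype κ]

open scoped Classical in
/-- The indices of the binomials `x ^ u k - x ^ v k` touching an isolated monomial of degree `b`. -/
noncomputable def touching (D : (σ →₀ ℕ) →+ M) (u v : κ → σ →₀ ℕ) (b : M) : Finset κ :=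
  Finset.univ.filter fun k => ∃ m, IsIsolated D m ∧ D m = b ∧ Touches (u k) (v k) m

lemma mem_touching {b : M} {k : κ} :
    k ∈ touching D u v b ↔ ∃ m, IsIsolated D m ∧ D m = b ∧ Touches (u k) (v k) m := by
  simp only [touching, Finset.mem_filter, Finset.mem_univ, true_and]

variable [IsLeftCancelAdd M] (hdeg : PreservesDegree D) (hsplit : SquarefreeOrSplit D)
  (hne : ∀ k, u k ≠ v k) (hD : ∀ k, D (u k) = D (v k))

include hdeg hsplit hne hD

lemma disjoint_touching {b b' : M} (hb : b ≠ b') :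
    Disjoint (touching D u v b) (touching D u v b') := by
  rw [Finset.disjoint_left]
  intro k hk hk'
  obtain ⟨m, hm, rfl, h⟩ := mem_touching.1 hk
  obtain ⟨m', hm', rfl, h'⟩ := mem_touching.1 hk'
  exact hb (h.map_eq hdeg hsplit (hD k) (hne k) hm hm' h')

variable (hrad : (fiberIdeal K D).radical =
  (Ideal.span (Set.range fun k => binomial K (u k) (v k))).radical)

include hrad

lemma IsUnlinkedTriple.one_lt_card_touching (htriple : UnlinkedTriplesExhaust D)
    {x y z : σ →₀ ℕ} (h : IsUnlinkedTriple D x y z) : 1 < (touching D u v (D x)).card := by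
  have hx := h.isIsolated hsplit htriple
  have hy := h.rotate.isIsolated hsplit htriple
  have hz := h.rotate.rotate.isIsolated hsplit htriple
  obtain ⟨i, hi⟩ := hx.exists_touches hdeg hrad
  obtain ⟨j, hj⟩ := hy.exists_touches hdeg hrad
  obtain ⟨k, hk⟩ := hz.exists_touches hdeg hrad
  by_contra! hle
  have hall := Finset.card_le_one.1 hle
  have hi' := mem_touching.2 ⟨x, hx, rfl, hi⟩
  obtain rfl := hall _ hi' _ (mem_touching.2 ⟨y, hy, h.map_eq₁₂.symm, hj⟩)
  obtain rfl := hall _ hi' _ (mem_touching.2 ⟨z, hz, h.map_eq₁₃.symm, hk⟩)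
  rcases hi.eq_or_eq_or_eq hdeg hsplit (hD i) (hne i) hx hy hz hj hk with rfl | rfl | rfl
  · exact h.unlinked₁₂ (.refl _)
  · exact h.unlinked₁₃ (.refl _)
  · exact h.unlinked₂₃ (.refl _)

lemma IsMinimalFamily.card_le_card {ι : Type*} [Fintype ι] {P Q : ι → σ →₀ ℕ}
    (h : IsMinimalFamily (fiberIdeal K D) P Q) (htriple : UnlinkedTriplesExhaust D)
    (hiso : ∀ i, IsIsolated D (P i) ∨ IsIsolated D (Q i)) :
    Fintype.card ι ≤ Fintype.card κ := by
  classical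
  refine card_le_card_of_disjoint_of_card_fiber_le (fun i => D (P i))
    (fun _ _ => disjoint_touching hdeg hsplit hne hD) fun i => ?_
  rcases le_or_gt (Finset.univ.filter fun j => D (P j) = D (P i)).card 1 with hle | hlt
  · refine hle.trans (Finset.card_pos.2 ?_)
    rcases hiso i with hm | hm
    · obtain ⟨k, hk⟩ := hm.exists_touches hdeg hrad
      exact ⟨k, mem_touching.2 ⟨_, hm, rfl, hk⟩⟩
    · obtain ⟨k, hk⟩ := hm.exists_touches hdeg hrad
      exact ⟨k, mem_touching.2 ⟨_, hm, (h.map_eq i).symm, hk⟩⟩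
  · have card_le_two : (Finset.univ.filter fun j => D (P j) = D (P i)).card ≤ 2 := by
      by_contra! hthree
      obtain ⟨a, b, c, ha, hb, hc, hab, hac, hbc⟩ := Finset.two_lt_card_iff.1 hthree
      simp only [Finset.mem_filter, Finset.mem_univ, true_and] at ha hb hc
      exact h.not_three hdeg htriple hab hac hbc (ha.trans hb.symm) (ha.trans hc.symm)
    refine card_le_two.trans ?_
    obtain ⟨a, ha, b, hb, hab⟩ := Finset.one_lt_card.1 hlt
    simp only [Finset.mem_filter, Finset.mem_univ, true_and] at ha hb
    rw [← ha]
    rcases h.exists_isUnlinkedTriple hdeg hab (ha.trans hb.symm) with ht | ht <;>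
      exact ht.one_lt_card_touching hdeg hsplit hne hD hrad htriple

end Counting

section BinomialArithmeticalRank

variable {σ K M : Type*} [Finite σ] [Field K] [AddCommMonoid M] [IsLeftCancelAdd M]
  {D : (σ →₀ ℕ) →+ M}

theorem bar_fiberIdeal_eq_mu (hdeg : PreservesDegree D) (hsplit : SquarefreeOrSplit D)
    (htriple : UnlinkedTriplesExhaust D)
    (hiso : ∀ m n, D m = D n → ¬ Linked D m n →
      IsMinimalBinomial (fiberIdeal K D) (binomial K m n) → IsIsolated D m ∨ IsIsolated D n) :
    bar (fiberIdeal K D) = mu (fiberIdeal K D) := by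
  have hgen := exists_isBinomialSystem_fiberIdeal K D
  refine (bar_le_mu hgen).antisymm ?_
  obtain ⟨B, hB, hrad⟩ := exists_radical_span_eq_of_bar hgen
  choose u v hne hBuv using fun k => (hB k).1
  obtain rfl : B = fun k => binomial K (u k) (v k) := funext hBuv
  obtain ⟨P, Q, h⟩ := exists_isMinimalFamily hgen
  simpa only [Fintype.card_fin] using h.card_le_card hdeg hsplit hne
    (fun k => binomial_mem_fiberIdeal.1 (hB k).2) hrad htriple fun i =>
      hiso _ _ (h.map_eq i) (h.not_linked hdeg i) (h.isMinimalBinomial i)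

end BinomialArithmeticalRank

section Toric

variable {σ τ K : Type*}

section PosNeg

variable [Finite σ]

lemma posExp_sub_negExp (u : σ → ℤ) : (fun i => (posExp u i : ℤ) - negExp u i) = u := by
  ext i
  simp only [posExp, negExp, Finsupp.equivFunOnFinite_symm_apply_apply]
  omega

lemma inf_add_posExp (m n : σ →₀ ℕ) : m ⊓ n + posExp (fun i => (m i : ℤ) - n i) = m := by
  ext i
  simp only [posExp, Finsupp.add_apply, Finsupp.inf_apply,
    Finsupp.equivFunOnFinite_symm_apply_apply]
  omega

lemma inf_add_negExp (m n : σ →₀ ℕ) : m ⊓ n + negExp (fun i => (m i : ℤ) - n i) = n := by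
  ext i
  simp only [negExp, Finsupp.add_apply, Finsupp.inf_apply,
    Finsupp.equivFunOnFinite_symm_apply_apply]
  omega

end PosNeg

variable [Fintype σ] [Field K]

/-- The degree of a monomial for the grading given by a vector configuration. -/
def configurationDegree (A : σ → τ → ℤ) : (σ →₀ ℕ) →+ (τ → ℤ) where
  toFun m := ∑ i, (m i : ℤ) • A i
  map_zero' := by simp only [Finsupp.coe_zero, Pi.zero_apply, Nat.cast_zero, zero_smul,
    Finset.sum_const_zero]
  map_add' m n := by simp only [Finsupp.coe_add, Pi.add_apply, Nat.cast_add, add_smul,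
    Finset.sum_add_distrib]

lemma sub_mem_kerZ_iff {A : σ → τ → ℤ} {m n : σ →₀ ℕ} :
    (fun i => (m i : ℤ) - n i) ∈ kerZ A ↔ configurationDegree A m = configurationDegree A n := by
  change ∑ i, ((m i : ℤ) - n i) • A i = 0 ↔ ∑ i, (m i : ℤ) • A i = ∑ i, (n i : ℤ) • A i
  simp only [sub_smul, Finset.sum_sub_distrib, sub_eq_zero]

lemma toricIdeal_eq_fiberIdeal (A : σ → τ → ℤ) :
    toricIdeal K A = fiberIdeal K (configurationDegree A) := by
  refine le_antisymm (Ideal.span_le.2 ?_) (fiberIdeal_le fun m n _ hD => ?_)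
  · rintro _ ⟨u, hu, rfl⟩
    rw [← posExp_sub_negExp u, sub_mem_kerZ_iff] at hu
    exact binomial_mem_fiberIdeal.2 hu
  · have hmem : vecBinomial K (fun i => (m i : ℤ) - n i) ∈ toricIdeal K A :=
      Ideal.subset_span ⟨_, sub_mem_kerZ_iff.2 hD, rfl⟩
    have hfactor : binomial K m n =
        monomial (m ⊓ n) 1 * vecBinomial K fun i => (m i : ℤ) - n i := by
      rw [vecBinomial, ← binomial, ← binomial_add_add, inf_add_posExp, inf_add_negExp]
    rw [hfactor]
    exact Ideal.mul_mem_left _ _ hmem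

end Toric

/-! ### Monomials of even closed walks -/

section WalkMonomials

variable {V : Type*} {G : SimpleGraph V} {a b c : V}

/-- The exponent vector of the variable of an edge. -/
noncomputable def edgeExp (h : G.Adj a b) : G.edgeSet →₀ ℕ := Finsupp.single ⟨s(a, b), h⟩ 1

lemma edgeExp_symm (h : G.Adj a b) : edgeExp h.symm = edgeExp h := by
  simp only [edgeExp, Sym2.eq_swap]

lemma edgeExp_ne_zero (h : G.Adj a b) : edgeExp h ≠ 0 :=
  Finsupp.single_ne_zero.2 one_ne_zero

@[simp] lemma walkPlus_nil : walkPlus (Walk.nil : G.Walk a a) = 0 := Finset.sum_empty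

@[simp] lemma walkMinus_nil : walkMinus (Walk.nil : G.Walk a a) = 0 := Finset.sum_empty

@[simp] lemma walkPlus_cons (h : G.Adj a b) (p : G.Walk b c) :
    walkPlus (p.cons h) = edgeExp h + walkMinus p :=
  (Fin.sum_univ_succ (n := p.darts.length) _).trans (by simp [Nat.even_add_one, walkMinus, edgeExp])

@[simp] lemma walkMinus_cons (h : G.Adj a b) (p : G.Walk b c) :
    walkMinus (p.cons h) = walkPlus p :=
  (Fin.sum_univ_succ (n := p.darts.length) _).trans (by simp [Nat.odd_add_one, walkPlus])

lemma walkPlus_walkMinus_append (p : G.Walk a b) (q : G.Walk b c) :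
    walkPlus (p.append q) = walkPlus p + (if Even p.length then walkPlus q else walkMinus q) ∧
      walkMinus (p.append q) =
        walkMinus p + (if Even p.length then walkMinus q else walkPlus q) := by
  induction p with
  | nil => simp
  | cons h p ih => by_cases hp : Even p.length <;> simp [ih, hp, Nat.even_add_one, add_assoc]

lemma walkPlus_append (p : G.Walk a b) (q : G.Walk b c) :
    walkPlus (p.append q) = walkPlus p + if Even p.length then walkPlus q else walkMinus q :=
  (walkPlus_walkMinus_append p q).1

lemma walkMinus_append (p : G.Walk a b) (q : G.Walk b c) :
    walkMinus (p.append q) = walkMinus p + if Even p.length then walkMinus q else walkPlus q :=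
  (walkPlus_walkMinus_append p q).2

lemma walkPlus_walkMinus_reverse (p : G.Walk a b) :
    walkPlus p.reverse = (if Even p.length then walkMinus p else walkPlus p) ∧
      walkMinus p.reverse = if Even p.length then walkPlus p else walkMinus p := by
  induction p with
  | nil => simp
  | cons h p ih =>
    have hs := edgeExp_symm h
    by_cases hp : Even p.length <;>
      simp [walkPlus_append, walkMinus_append, ih, hp, hs, Nat.even_add_one, add_comm (edgeExp h)]

lemma walkPlus_reverse (p : G.Walk a b) :
    walkPlus p.reverse = if Even p.length then walkMinus p else walkPlus p :=
  (walkPlus_walkMinus_reverse p).1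

lemma walkMinus_reverse (p : G.Walk a b) :
    walkMinus p.reverse = if Even p.length then walkPlus p else walkMinus p :=
  (walkPlus_walkMinus_reverse p).2

lemma walkPlus_add_walkMinus_apply [DecidableEq V] (p : G.Walk a b) (e : G.edgeSet) :
    walkPlus p e + walkMinus p e = p.edges.count (e : Sym2 V) := by
  induction p with
  | nil => simp
  | @cons u v w h p ih =>
    have hedge : edgeExp h e = if s(u, v) = (e : Sym2 V) then 1 else 0 := by
      rw [edgeExp, Finsupp.single_apply]
      exact if_congr Subtype.ext_iff rfl rfl
    simp only [Walk.edges_cons, List.count_cons, ← ih, walkPlus_cons, walkMinus_cons,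
      Finsupp.add_apply, hedge, beq_iff_eq]
    ring

lemma mem_edges_iff (p : G.Walk a b) (e : G.edgeSet) :
    (e : Sym2 V) ∈ p.edges ↔ walkPlus p e ≠ 0 ∨ walkMinus p e ≠ 0 := by
  classical
  rw [← List.count_pos_iff, ← walkPlus_add_walkMinus_apply]
  omega

lemma walkPlus_ne_zero {p : G.Walk a b} (h : 0 < p.length) : walkPlus p ≠ 0 := by
  cases p with
  | nil => exact absurd h (lt_irrefl 0)
  | cons hadj p =>
    rw [walkPlus_cons]
    exact fun h0 => edgeExp_ne_zero hadj (add_eq_zero.1 h0).1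

lemma walkMinus_ne_zero {p : G.Walk a b} (h : 1 < p.length) : walkMinus p ≠ 0 := by
  cases p with
  | nil => exact absurd h (Nat.not_lt_zero 1)
  | cons hadj p =>
    rw [walkMinus_cons]
    exact walkPlus_ne_zero (Nat.lt_of_succ_lt_succ h)

lemma degree_walkPlus_add_walkMinus (p : G.Walk a b) :
    (walkPlus p).degree + (walkMinus p).degree = p.length := by
  induction p with
  | nil => simp
  | cons h p ih =>
    rw [walkPlus_cons, walkMinus_cons, map_add, edgeExp, Finsupp.degree_single, Walk.length_cons,
      ← ih]
    ring

end WalkMonomials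

section Endpoints

variable {V : Type*} {G : SimpleGraph V} {a b : V} {m n : G.edgeSet →₀ ℕ}

variable (G) in
/-- The multiset of end points of the edges of a monomial, which encodes its degree for the
grading by the vertices. -/
noncomputable def endpoints : (G.edgeSet →₀ ℕ) →+ Multiset V :=
  Finsupp.liftAddHom fun e => multiplesHom _ (e : Sym2 V).toMultiset

lemma endpoints_apply (m : G.edgeSet →₀ ℕ) :
    endpoints G m = m.sum fun e n => n • (e : Sym2 V).toMultiset := rfl

@[simp] lemma endpoints_edgeExp (h : G.Adj a b) : endpoints G (edgeExp h) = {a} + {b} :=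
  (Finsupp.liftAddHom_apply_single _ _ _).trans (one_smul ℕ _)

lemma card_endpoints (m : G.edgeSet →₀ ℕ) : (endpoints G m).card = 2 * m.degree := by
  simp only [endpoints_apply, Finsupp.sum, Multiset.card_sum, Multiset.card_nsmul,
    Sym2.card_toMultiset, Finsupp.degree_apply, Finset.mul_sum, mul_comm]

variable (G) in
lemma preservesDegree_endpoints : PreservesDegree (endpoints G) := fun m n h => by
  have := card_endpoints m
  rw [h, card_endpoints] at this
  omega

lemma endpoints_mono (h : m ≤ n) : endpoints G m ≤ endpoints G n := by
  obtain ⟨k, rfl⟩ := le_iff_exists_add.1 h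
  rw [map_add]
  exact Multiset.le_add_right _ _

lemma endpoints_eq_zero : endpoints G m = 0 ↔ m = 0 := by
  rw [← Multiset.card_eq_zero, card_endpoints, mul_eq_zero, Finsupp.degree_eq_zero_iff]
  exact or_iff_right two_ne_zero

lemma mem_endpoints {v : V} : v ∈ endpoints G m ↔ ∃ e : G.edgeSet, m e ≠ 0 ∧ v ∈ (e : Sym2 V) := by
  simp [endpoints_apply, Finsupp.sum, Multiset.mem_sum, Multiset.mem_nsmul]

lemma exists_edgeExp_le_of_mem_endpoints {v : V} (h : v ∈ endpoints G m) :
    ∃ (u : V) (hu : G.Adj v u), edgeExp hu ≤ m := by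
  obtain ⟨⟨e, he⟩, hm, hv⟩ := mem_endpoints.1 h
  obtain ⟨u, rfl⟩ := Sym2.mem_iff_exists.1 hv
  exact ⟨u, he, Finsupp.single_le_iff.2 (Nat.one_le_iff_ne_zero.2 hm)⟩

lemma endpoints_walk (p : G.Walk a b) :
    if Even p.length then endpoints G (walkPlus p) + {b} = endpoints G (walkMinus p) + {a}
    else endpoints G (walkPlus p) = endpoints G (walkMinus p) + ({a} + {b}) := by
  induction p with
  | nil => simp
  | @cons x y z h p ih =>
    by_cases hp : Even p.length
    · simp only [hp, if_true] at ih
      simp only [Walk.length_cons, Nat.even_add_one, hp, not_true, if_false, walkPlus_cons,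
        walkMinus_cons, map_add, endpoints_edgeExp]
      rw [add_assoc, add_comm ({y} : Multiset V), ← ih]
      abel
    · simp only [hp, if_false] at ih
      simp only [Walk.length_cons, Nat.even_add_one, hp, not_false_eq_true, if_true, walkPlus_cons,
        walkMinus_cons, map_add, endpoints_edgeExp, ih]
      abel

lemma endpoints_walkPlus_of_even {p : G.Walk a b} (h : Even p.length) :
    endpoints G (walkPlus p) + {b} = endpoints G (walkMinus p) + {a} := by
  simpa only [h, if_true] using endpoints_walk p

lemma endpoints_walkPlus_of_odd {p : G.Walk a b} (h : Odd p.length) :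
    endpoints G (walkPlus p) = endpoints G (walkMinus p) + ({a} + {b}) := by
  simpa only [Nat.not_even_iff_odd.2 h, if_false] using endpoints_walk p

lemma endpoints_walkPlus_eq_walkMinus {p : G.Walk a a} (h : Even p.length) :
    endpoints G (walkPlus p) = endpoints G (walkMinus p) :=
  add_right_cancel (endpoints_walkPlus_of_even h)

lemma endpoints_walk_eq_support (p : G.Walk a b) :
    if Even p.length then endpoints G (walkMinus p) = p.support.tail
    else endpoints G (walkPlus p) = p.support := by
  induction p with
  | nil => simp
  | @cons x y z h p ih =>
    by_cases hp : Even p.length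
    · simp only [hp, if_true] at ih
      simp only [Walk.length_cons, Nat.even_add_one, hp, not_true, if_false, walkPlus_cons,
        map_add, endpoints_edgeExp, ih, Walk.support_cons]
      conv_rhs => rw [← p.cons_tail_support, ← Multiset.cons_coe, ← Multiset.cons_coe]
      simp only [← Multiset.singleton_add, add_assoc]
    · simpa only [Walk.length_cons, Nat.even_add_one, hp, not_false_eq_true, if_true, if_false,
        walkMinus_cons, Walk.support_cons, List.tail_cons] using ih

lemma endpoints_walkPlus_eq_support_tail {p : G.Walk a a} (h : Even p.length) :
    endpoints G (walkPlus p) = p.support.tail := by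
  rw [endpoints_walkPlus_eq_walkMinus h]
  simpa only [h, if_true] using endpoints_walk_eq_support p

end Endpoints

section PrimitivePair

variable {σ M : Type*} [AddCommMonoid M] {D : (σ →₀ ℕ) →+ M} {m n : σ →₀ ℕ}

/-- A nontrivial pair of monomials of one degree is primitive if it contains no smaller one. -/
def IsPrimitivePair (D : (σ →₀ ℕ) →+ M) (m n : σ →₀ ℕ) : Prop :=
  Minimal (fun p : (σ →₀ ℕ) × (σ →₀ ℕ) => D p.1 = D p.2 ∧ p ≠ 0) (m, n)

lemma IsPrimitivePair.symm (h : IsPrimitivePair D m n) : IsPrimitivePair D n m :=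
  ⟨⟨h.1.1.symm, mt Prod.swap_inj.2 h.1.2⟩, fun p hp hle =>
    Prod.swap_le_swap.1 (h.2 (y := p.swap) ⟨hp.1.symm, mt (Prod.swap_inj (q := 0)).1 hp.2⟩
      (Prod.swap_le_swap.2 hle))⟩

lemma exists_isPrimitivePair_le (hD : D m = D n) (hm : m ≠ 0) :
    ∃ m' ≤ m, ∃ n' ≤ n, IsPrimitivePair D m' n' := by
  obtain ⟨p, hp, hmin⟩ := exists_minimal_le_of_wellFoundedLT
    (fun p : (σ →₀ ℕ) × (σ →₀ ℕ) => D p.1 = D p.2 ∧ p ≠ 0) (m, n)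
    ⟨hD, fun h => hm (congrArg Prod.fst h)⟩
  exact ⟨p.1, hp.1, p.2, hp.2, hmin⟩

end PrimitivePair

section PrimitiveWalk

variable {V : Type*} {G : SimpleGraph V} {a b x z : V}

/-- The two alternating monomials of a walk, without their order. -/
noncomputable def walkPair (w : G.Walk a b) : Sym2 (G.edgeSet →₀ ℕ) := s(walkPlus w, walkMinus w)

lemma length_eq_of_walkPair_eq {w : G.Walk a a} {w' : G.Walk b b} (h : walkPair w = walkPair w') :
    w.length = w'.length := by
  rw [← degree_walkPlus_add_walkMinus, ← degree_walkPlus_add_walkMinus]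
  rcases Sym2.eq_iff.1 h with ⟨h₁, h₂⟩ | ⟨h₁, h₂⟩ <;> rw [h₁, h₂]
  exact add_comm _ _

lemma rel_of_walkPair_eq {r : (G.edgeSet →₀ ℕ) → (G.edgeSet →₀ ℕ) → Prop}
    (hr : ∀ {m n}, r m n → r n m) {w : G.Walk a a} {w' : G.Walk b b}
    (h : walkPair w = walkPair w') (hw : r (walkPlus w) (walkMinus w)) :
    r (walkPlus w') (walkMinus w') := by
  rcases Sym2.eq_iff.1 h with ⟨h₁, h₂⟩ | ⟨h₁, h₂⟩
  · rwa [← h₁, ← h₂]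
  · rw [← h₁, ← h₂]
    exact hr hw

lemma walkPair_rotate (p : G.Walk a b) (q : G.Walk b a) (h : Even (p.append q).length) :
    walkPair (p.append q) = walkPair (q.append p) := by
  rw [Walk.length_append, Nat.even_add] at h
  refine Sym2.eq_iff.2 ?_
  by_cases hp : Even p.length
  · simp [walkPlus_append, walkMinus_append, hp, h.1 hp, add_comm]
  · simp [walkPlus_append, walkMinus_append, hp, mt h.2 hp, add_comm]

/-- An even closed walk whose two alternating monomials form a primitive pair. -/
def IsPrimitiveWalk (w : G.Walk a a) : Prop :=
  Even w.length ∧ IsPrimitivePair (endpoints G) (walkPlus w) (walkMinus w)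

lemma IsPrimitiveWalk.length_pos {w : G.Walk a a} (h : IsPrimitiveWalk w) : 0 < w.length := by
  cases w with
  | nil => exact absurd (by simp) h.2.1.2
  | cons => exact Nat.succ_pos _

lemma IsPrimitiveWalk.of_walkPair_eq {w : G.Walk a a} {w' : G.Walk b b} (h : IsPrimitiveWalk w)
    (heq : walkPair w = walkPair w') : IsPrimitiveWalk w' :=
  ⟨length_eq_of_walkPair_eq heq ▸ h.1,
    rel_of_walkPair_eq (r := IsPrimitivePair (endpoints G)) .symm heq h.2⟩

lemma IsPrimitiveWalk.rotate {p : G.Walk a b} {q : G.Walk b a}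
    (h : IsPrimitiveWalk (p.append q)) : IsPrimitiveWalk (q.append p) :=
  h.of_walkPair_eq (walkPair_rotate p q h.1)

lemma IsPrimitiveWalk.length_le {w : G.Walk a a} {w' : G.Walk b b} (h : IsPrimitiveWalk w)
    (heven : Even w'.length) (hpos : 0 < w'.length) (hplus : walkPlus w' ≤ walkPlus w)
    (hminus : walkMinus w' ≤ walkMinus w) : w.length ≤ w'.length := by
  have hle := h.2.2 (y := (walkPlus w', walkMinus w')) ⟨endpoints_walkPlus_eq_walkMinus heven,
    fun h0 => walkPlus_ne_zero hpos (congrArg Prod.fst h0)⟩ ⟨hplus, hminus⟩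
  rw [← degree_walkPlus_add_walkMinus, ← degree_walkPlus_add_walkMinus w']
  exact add_le_add (Finsupp.degree_mono hle.1) (Finsupp.degree_mono hle.2)

lemma IsPrimitiveWalk.odd_left {c q : G.Walk a a} (h : IsPrimitiveWalk (c.append q))
    (hc : 0 < c.length) (hq : 0 < q.length) : Odd c.length := by
  by_contra heven
  have := h.length_le (Nat.not_odd_iff_even.1 heven) hc
    (walkPlus_append c q ▸ le_self_add) (walkMinus_append c q ▸ le_self_add)
  rw [Walk.length_append] at this
  omega

lemma IsPrimitiveWalk.odd_right {c q : G.Walk a a} (h : IsPrimitiveWalk (c.append q))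
    (hc : 0 < c.length) (hq : 0 < q.length) : Odd q.length :=
  h.rotate.odd_left hq hc

lemma length_pos_of_ne (p : G.Walk a b) (h : a ≠ b) : 0 < p.length :=
  Nat.pos_of_ne_zero (mt Walk.eq_of_length_eq_zero h)

lemma walkPlus_append_reverse_le {p₁ p₂ : G.Walk x z} {q₁ q₂ : G.Walk z x}
    (hp : Even (p₁.append p₂.reverse).length) (hq : Odd (p₁.append q₁).length) :
    walkPlus (p₁.append p₂.reverse) ≤ walkPlus ((p₁.append q₁).append (p₂.append q₂)) ∧
      walkMinus (p₁.append p₂.reverse) ≤ walkMinus ((p₁.append q₁).append (p₂.append q₂)) := by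
  simp only [Walk.length_append, Walk.length_reverse, ← Nat.not_even_iff_odd, Nat.even_add]
    at hp hq
  simp only [walkPlus_append, walkMinus_append, walkPlus_reverse, walkMinus_reverse,
    Walk.length_append, Nat.even_add, hq, if_false, ← hp]
  split_ifs with h <;>
    exact ⟨add_le_add le_self_add le_self_add, add_le_add le_self_add le_self_add⟩

/-- Replacing `p₂` by its reverse joins the two passages from `x` to `z` to a shorter walk. -/
lemma not_isPrimitiveWalk_of_crossing (hxz : x ≠ z) (p₁ p₂ : G.Walk x z) (q₁ q₂ : G.Walk z x) :
    ¬ IsPrimitiveWalk ((p₁.append q₁).append (p₂.append q₂)) := by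
  intro h
  have hp₁ := length_pos_of_ne p₁ hxz
  have hq₁ := length_pos_of_ne q₁ hxz.symm
  have hp₂ := length_pos_of_ne p₂ hxz
  have hodd : Odd (p₁.append q₁).length :=
    h.odd_left (by simp; omega) (by simp; omega)
  have hodd' : Odd (q₁.append p₂).length := by
    rw [← Walk.append_assoc] at h
    have h' := h.rotate
    rw [Walk.append_assoc, ← Walk.append_assoc (q₁.append p₂)] at h'
    exact h'.odd_left (by simp; omega) (by simp; omega)
  have heven : Even (p₁.append p₂.reverse).length := by
    simp only [Walk.length_append, Walk.length_reverse, ← Nat.not_even_iff_odd, Nat.even_add]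
      at hodd hodd' ⊢
    tauto
  have hle := walkPlus_append_reverse_le (q₁ := q₁) (q₂ := q₂) heven hodd
  have := h.length_le heven (by simp; omega) hle.1 hle.2
  simp only [Walk.length_append, Walk.length_reverse] at this
  omega

lemma IsPrimitiveWalk.eq_of_mem_support {c q : G.Walk x x} (h : IsPrimitiveWalk (c.append q))
    (hc : z ∈ c.support) (hq : z ∈ q.support) : z = x := by
  by_contra hne
  obtain ⟨p₁, q₁, rfl⟩ := Walk.mem_support_iff_exists_append.1 hc
  obtain ⟨p₂, q₂, rfl⟩ := Walk.mem_support_iff_exists_append.1 hq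
  exact not_isPrimitiveWalk_of_crossing (Ne.symm hne) p₁ p₂ q₁ q₂ h

end PrimitiveWalk

section AlternatingWalk

variable {V : Type*} {G : SimpleGraph V} {a b c x z u : V} {m n : G.edgeSet →₀ ℕ}

lemma walkPlus_concat (p : G.Walk a b) (h : G.Adj b c) :
    walkPlus (p.concat h) = walkPlus p + if Even p.length then edgeExp h else 0 := by
  simp [Walk.concat_eq_append, walkPlus_append]

lemma walkMinus_concat (p : G.Walk a b) (h : G.Adj b c) :
    walkMinus (p.concat h) = walkMinus p + if Even p.length then 0 else edgeExp h := by
  simp [Walk.concat_eq_append, walkMinus_append]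

lemma exists_concat_le (hD : endpoints G m = endpoints G n) {p : G.Walk a b}
    (hm : walkPlus p ≤ m) (hn : walkMinus p ≤ n) (hp : ¬ (a = b ∧ Even p.length)) :
    ∃ (c : V) (h : G.Adj b c), walkPlus (p.concat h) ≤ m ∧ walkMinus (p.concat h) ≤ n := by
  obtain ⟨m', rfl⟩ := le_iff_exists_add.1 hm
  obtain ⟨n', rfl⟩ := le_iff_exists_add.1 hn
  simp only [map_add] at hD
  by_cases heven : Even p.length
  · have hrest : {b} + endpoints G n' = {a} + endpoints G m' := by
      refine add_left_cancel (a := endpoints G (walkMinus p)) ?_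
      rw [add_left_comm, ← hD, ← add_assoc, add_comm ({b} : Multiset V),
        endpoints_walkPlus_of_even heven, add_assoc]
    have hb : b ∈ endpoints G m' :=
      (Multiset.mem_add.1 (hrest ▸ Multiset.mem_add.2 (.inl (Multiset.mem_singleton_self b)))
        ).resolve_left fun h => hp ⟨(Multiset.mem_singleton.1 h).symm, heven⟩
    obtain ⟨c, h, hle⟩ := exists_edgeExp_le_of_mem_endpoints hb
    exact ⟨c, h, by simpa [walkPlus_concat, heven] using hle, by simp [walkMinus_concat, heven]⟩
  · have hrest : {a} + {b} + endpoints G m' = endpoints G n' := by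
      refine add_left_cancel (a := endpoints G (walkMinus p)) ?_
      rw [← hD, endpoints_walkPlus_of_odd (Nat.not_even_iff_odd.1 heven)]
      simp only [add_assoc]
    obtain ⟨c, h, hle⟩ := exists_edgeExp_le_of_mem_endpoints (m := n') (v := b)
      (by simp [← hrest])
    exact ⟨c, h, by simp [walkPlus_concat, heven], by simpa [walkMinus_concat, heven] using hle⟩

lemma exists_alternating_closed_walk (hD : endpoints G m = endpoints G n) (hm : m ≠ 0) :
    ∃ (a : V) (w : G.Walk a a),
      Even w.length ∧ 0 < w.length ∧ walkPlus w ≤ m ∧ walkMinus w ≤ n := by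
  let lengths : Set ℕ := {l | ∃ (a b : V) (p : G.Walk a b),
    p.length = l ∧ 0 < l ∧ walkPlus p ≤ m ∧ walkMinus p ≤ n}
  have hne : lengths.Nonempty := by
    obtain ⟨v, hv⟩ := Multiset.exists_mem_of_ne_zero (mt endpoints_eq_zero.1 hm)
    obtain ⟨u, h, hle⟩ := exists_edgeExp_le_of_mem_endpoints hv
    exact ⟨1, v, u, .cons h .nil, rfl, one_pos, by simpa using hle, by simp⟩
  have hbdd : BddAbove lengths := by
    refine ⟨m.degree + n.degree, ?_⟩
    rintro _ ⟨a, b, p, rfl, -, hpm, hpn⟩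
    rw [← degree_walkPlus_add_walkMinus]
    exact add_le_add (Finsupp.degree_mono hpm) (Finsupp.degree_mono hpn)
  obtain ⟨_, ⟨a, b, p, rfl, hpos, hpm, hpn⟩, hmax⟩ := hbdd.exists_isGreatest_of_nonempty hne
  by_cases hp : a = b ∧ Even p.length
  · obtain ⟨rfl, heven⟩ := hp
    exact ⟨a, p, heven, hpos, hpm, hpn⟩
  · obtain ⟨c, h, hcm, hcn⟩ := exists_concat_le hD hpm hpn hp
    have := hmax ⟨a, c, p.concat h, p.length_concat h, Nat.succ_pos _, hcm, hcn⟩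
    omega

lemma IsPrimitivePair.exists_walk (h : IsPrimitivePair (endpoints G) m n) :
    ∃ (a : V) (w : G.Walk a a), IsPrimitiveWalk w ∧ walkPlus w = m ∧ walkMinus w = n := by
  have hm : m ≠ 0 := by
    rintro rfl
    have hn : n = 0 := endpoints_eq_zero.1 (by simpa using h.1.1.symm)
    exact h.1.2 (by rw [hn]; rfl)
  obtain ⟨a, w, heven, hpos, hwm, hwn⟩ := exists_alternating_closed_walk h.1.1 hm
  have hle := h.2 (y := (walkPlus w, walkMinus w)) ⟨endpoints_walkPlus_eq_walkMinus heven,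
    fun h0 => walkPlus_ne_zero hpos (congrArg Prod.fst h0)⟩ ⟨hwm, hwn⟩
  obtain rfl := hwm.antisymm hle.1
  obtain rfl := hwn.antisymm hle.2
  exact ⟨a, w, ⟨heven, h⟩, rfl, rfl⟩

end AlternatingWalk

section Chord

variable {V : Type*} {G : SimpleGraph V} {x z u : V}

lemma walkPlus_append_of_odd {s : G.Walk z u} (hs : Odd s.length) (t : G.Walk u x) :
    walkPlus (s.append t) = walkPlus s + walkMinus t := by
  rw [walkPlus_append, if_neg (Nat.not_even_iff_odd.2 hs)]

lemma walkMinus_append_of_odd {s : G.Walk z u} (hs : Odd s.length) (t : G.Walk u x) :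
    walkMinus (s.append t) = walkMinus s + walkPlus t := by
  rw [walkMinus_append, if_neg (Nat.not_even_iff_odd.2 hs)]

lemma endpoints_walkPlus_of_odd_chord {s : G.Walk z u} (hs : Odd s.length) (h : G.Adj z u) :
    endpoints G (walkPlus s) = endpoints G (walkMinus s + edgeExp h) := by
  rw [endpoints_walkPlus_of_odd hs, map_add, endpoints_edgeExp]

section OddChord

variable {s : G.Walk z u} {t : G.Walk u z} (hs : Odd s.length) (ht : Odd t.length)
  (hs1 : 1 < s.length) (ht1 : 1 < t.length) (h : G.Adj z u)

include hs ht hs1 ht1 h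

lemma linked_of_odd_chord :
    Linked (endpoints G) (walkPlus (s.append t)) (walkMinus (s.append t)) := by
  rw [walkPlus_append_of_odd hs, walkMinus_append_of_odd hs]
  exact linked_of_exchange (endpoints_walkPlus_of_odd_chord hs h)
    (edgeExp_symm h ▸ (endpoints_walkPlus_of_odd_chord ht h.symm).symm)
    (walkMinus_ne_zero ht1) (walkMinus_ne_zero hs1)

lemma isSplit_of_odd_chord {e : G.edgeSet} (het : walkMinus t e ≠ 0)
    (hes : (e : Sym2 V) ∉ s.edges) :
    IsSplit (endpoints G) (walkPlus (s.append t)) (walkMinus (s.append t)) := by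
  refine ⟨edgeExp h, walkPlus s, walkMinus t, walkMinus s, walkPlus t,
    walkPlus_append_of_odd hs t, walkMinus_append_of_odd hs t, endpoints_walkPlus_of_odd_chord hs h,
    edgeExp_symm h ▸ (endpoints_walkPlus_of_odd_chord ht h.symm).symm,
    walkMinus_ne_zero ht1, walkMinus_ne_zero hs1, .inr (.inl fun hsub => hes ?_)⟩
  exact (mem_edges_iff s e).2 (.inl (Finsupp.mem_support_iff.1
    (hsub (Finsupp.mem_support_iff.2 het))))

end OddChord

lemma isSplit_of_odd_chord_between {p₁ : G.Walk x z} {p₂ : G.Walk z x} {q₁ : G.Walk x u}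
    {q₂ : G.Walk u x} (hz : z ≠ x) (hu : u ≠ x) (hp : Odd (p₁.append p₂).length)
    (hq : Odd (q₁.append q₂).length) (hs : Odd (p₂.append q₁).length)
    (hnodup : (p₁.append p₂).edges.Nodup)
    (hdis : ∀ e ∈ (p₁.append p₂).edges, e ∉ (q₁.append q₂).edges) (h : G.Adj z u) :
    IsSplit (endpoints G) (walkPlus ((p₁.append p₂).append (q₁.append q₂)))
      (walkMinus ((p₁.append p₂).append (q₁.append q₂))) := by
  have hp₁0 := length_pos_of_ne p₁ hz.symm
  have hp₂0 := length_pos_of_ne p₂ hz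
  have hq₁0 := length_pos_of_ne q₁ hu.symm
  have hq₂0 := length_pos_of_ne q₂ hu
  have hs1 : 1 < (p₂.append q₁).length := by simp; omega
  have ht1 : 1 < (q₂.append p₁).length := by simp; omega
  simp only [Walk.edges_append, List.nodup_append, List.mem_append] at hnodup hdis
  have ht : Odd (q₂.append p₁).length := by simp at *; grind
  have hassoc : (p₁.append p₂).append (q₁.append q₂) =
      p₁.append ((p₂.append q₁).append q₂) := by simp only [Walk.append_assoc]
  have hpair : walkPair ((p₁.append p₂).append (q₁.append q₂)) =
      walkPair ((p₂.append q₁).append (q₂.append p₁)) := by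
    rw [hassoc, walkPair_rotate _ _ (by simp at *; grind), Walk.append_assoc]
  rcases Nat.even_or_odd p₁.length with hp₁ | hp₁
  · refine rel_of_walkPair_eq (r := IsSplit _) .symm hpair.symm ?_
    have hq₂ : ¬ Even q₂.length := by simp at ht; grind
    obtain ⟨e, he⟩ := Finsupp.ne_iff.1 (walkPlus_ne_zero hp₁0)
    have hmem : (e : Sym2 V) ∈ p₁.edges := (mem_edges_iff p₁ e).2 (.inl he)
    refine isSplit_of_odd_chord hs ht hs1 ht1 h (e := e) ?_ ?_
    · rw [walkMinus_append, if_neg hq₂]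
      exact ne_zero_of_lt (lt_of_lt_of_le (Nat.pos_of_ne_zero he) le_add_self)
    · rw [Walk.edges_append, List.mem_append]
      grind
  · refine rel_of_walkPair_eq (r := IsSplit _) .symm
      (hpair.trans (walkPair_rotate _ _ (by simp at *; grind))).symm ?_
    have hp₂ : Even p₂.length := by simp at hp; grind
    obtain ⟨e, he⟩ := Finsupp.ne_iff.1 (walkMinus_ne_zero (p := p₂) (by grind))
    have hmem : (e : Sym2 V) ∈ p₂.edges := (mem_edges_iff p₂ e).2 (.inr he)
    refine isSplit_of_odd_chord ht hs ht1 hs1 h.symm (e := e) ?_ ?_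
    · rw [walkMinus_append, if_pos hp₂]
      exact ne_zero_of_lt (lt_of_lt_of_le (Nat.pos_of_ne_zero he) le_self_add)
    · rw [Walk.edges_append, List.mem_append]
      grind

lemma edges_disjoint_of_support {c q : G.Walk x x}
    (h : ∀ z ∈ c.support, z ∈ q.support → z = x) : c.edges.Disjoint q.edges := by
  rintro ⟨s, t⟩ hc hq
  have hs := h s (c.fst_mem_support_of_mem_edges hc) (q.fst_mem_support_of_mem_edges hq)
  have ht := h t (c.snd_mem_support_of_mem_edges hc) (q.snd_mem_support_of_mem_edges hq)
  exact (c.adj_of_mem_edges hc).ne (hs.trans ht.symm)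

lemma walkPlus_reverse_append {c : G.Walk x x} (hc : Odd c.length) (q : G.Walk x x) :
    walkPlus (c.reverse.append q) = walkPlus (c.append q) := by
  simp only [walkPlus_append, walkPlus_reverse, Walk.length_reverse, Nat.not_even_iff_odd.2 hc,
    if_false]

lemma walkMinus_reverse_append {c : G.Walk x x} (hc : Odd c.length) (q : G.Walk x x) :
    walkMinus (c.reverse.append q) = walkMinus (c.append q) := by
  simp only [walkMinus_append, walkMinus_reverse, Walk.length_reverse, Nat.not_even_iff_odd.2 hc,
    if_false]

lemma IsPrimitiveWalk.isSplit_of_chord {c q : G.Walk x x} (hw : IsPrimitiveWalk (c.append q))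
    (hc : c.IsCycle) (hq : 0 < q.length) (hzc : z ∈ c.support) (huq : u ∈ q.support)
    (hz : z ≠ x) (hu : u ≠ x) (h : G.Adj z u) :
    IsSplit (endpoints G) (walkPlus (c.append q)) (walkMinus (c.append q)) := by
  have hc0 : 0 < c.length := by have := hc.three_le_length; omega
  have hcodd := hw.odd_left hc0 hq
  have hqodd := hw.odd_right hc0 hq
  have hdis : ∀ e ∈ c.edges, e ∉ q.edges :=
    edges_disjoint_of_support fun _ => hw.eq_of_mem_support
  have hnodup := hc.edges_nodup
  obtain ⟨p₁, p₂, rfl⟩ := Walk.mem_support_iff_exists_append.1 hzc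
  obtain ⟨q₁, q₂, rfl⟩ := Walk.mem_support_iff_exists_append.1 huq
  rcases Nat.even_or_odd (p₂.append q₁).length with hs | hs
  · have hrev : (p₁.append p₂).reverse = p₂.reverse.append p₁.reverse := Walk.reverse_append _ _
    have key := isSplit_of_odd_chord_between (p₁ := p₂.reverse) (p₂ := p₁.reverse) (q₁ := q₁)
      (q₂ := q₂) hz hu (by rwa [← hrev, Walk.length_reverse]) hqodd (by simp at *; grind)
      (by rwa [← hrev, Walk.edges_reverse, List.nodup_reverse])
      (by simpa only [← hrev, Walk.edges_reverse, List.mem_reverse] using hdis) h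
    rwa [← hrev, walkPlus_reverse_append hcodd, walkMinus_reverse_append hcodd] at key
  · exact isSplit_of_odd_chord_between hz hu hcodd hqodd hs hnodup hdis h

end Chord

/-! ### Shortest odd closed walks and condition (♯) -/

section Shortest

variable {V : Type*} {G : SimpleGraph V} {a b x y s t : V} {A B S T U : Set V}

lemma mem_edges_of_length_eq_one (p : G.Walk a b) (h : p.length = 1) : s(a, b) ∈ p.edges := by
  cases p with
  | nil => simp at h
  | cons _ p =>
    obtain rfl := Walk.eq_of_length_eq_zero (p := p) (by simpa using h)
    simp

lemma exists_closed_subwalk (w : G.Walk a b) (h : ¬ w.support.Nodup) :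
    ∃ (x : V) (p : G.Walk a x) (c : G.Walk x x) (q : G.Walk x b),
      w = p.append (c.append q) ∧ 0 < c.length ∧ c.support.tail.Nodup := by
  induction w with
  | nil => simp at h
  | @cons a v b hadj p ih =>
    by_cases hp : p.support.Nodup
    · have ha : a ∈ p.support := by
        by_contra ha
        exact h (by simpa using ⟨ha, hp⟩)
      obtain ⟨p₁, p₂, rfl⟩ := Walk.mem_support_iff_exists_append.1 ha
      refine ⟨a, .nil, .cons hadj p₁, p₂, by simp, by simp, ?_⟩
      rw [Walk.support_append] at hp
      simpa using (List.nodup_append.1 hp).1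
    · obtain ⟨x, p', c, q, rfl, hc, hnodup⟩ := ih hp
      exact ⟨x, .cons hadj p', c, q, by simp, hc, hnodup⟩

lemma exists_closed_decomposition {w : G.Walk a a} (hw : 0 < w.length)
    (h : ¬ w.support.tail.Nodup) :
    ∃ (x : V) (p : G.Walk a x) (c : G.Walk x x) (q : G.Walk x a),
      w = p.append (c.append q) ∧ 0 < p.length ∧ 0 < c.length ∧ c.support.tail.Nodup := by
  cases w with
  | nil => simp at hw
  | cons hadj p =>
    obtain ⟨x, p', c, q, rfl, hc, hnodup⟩ := exists_closed_subwalk p (by simpa using h)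
    exact ⟨x, .cons hadj p', c, q, by simp, by simp, hc, hnodup⟩

lemma isCycle_of_nodup {w : G.Walk a a} (h : w.support.tail.Nodup) (hw : 3 ≤ w.length) :
    w.IsCycle := by
  rw [Walk.isCycle_iff_isPath_tail_and_le_length]
  refine ⟨?_, hw⟩
  cases w with
  | nil => simp at hw
  | cons hadj p => simpa [Walk.isPath_def] using h

lemma isCycle_of_odd {w : G.Walk a a} (h : w.support.tail.Nodup) (hw : Odd w.length) :
    w.IsCycle := by
  have hne : w.length ≠ 1 := fun h1 => G.irrefl (Walk.adj_of_length_eq_one h1)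
  exact isCycle_of_nodup h (by grind)

lemma exists_odd_even_walk {k : G.Walk a a} (hk : Odd k.length) (hs : s ∈ k.support)
    (ht : t ∈ k.support) : ∃ p q : G.Walk s t, Odd p.length ∧ Even q.length ∧
      p.length + q.length = k.length ∧ (∀ z ∈ p.support, z ∈ k.support) ∧
      (∀ z ∈ q.support, z ∈ k.support) ∧ ∀ e ∈ p.edges, e ∈ k.edges := by
  classical
  have hsupp z : z ∈ (k.rotate s hs).support ↔ z ∈ k.support := k.mem_support_rotate_iff s hs
  have hedges e : e ∈ (k.rotate s hs).edges ↔ e ∈ k.edges :=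
    (k.rotate_edges s hs).perm.mem_iff
  have hlen := k.length_rotate s hs
  obtain ⟨p, q, hpq⟩ := Walk.mem_support_iff_exists_append.1 ((hsupp t).2 ht)
  simp only [hpq, Walk.mem_support_append_iff] at hsupp
  simp only [hpq, Walk.edges_append, List.mem_append] at hedges
  rw [hpq, Walk.length_append] at hlen
  rw [← hlen] at hk
  rcases Nat.even_or_odd p.length with hp | hp
  · refine ⟨q.reverse, p, ?_, hp, by simp [← hlen, add_comm], ?_, ?_, ?_⟩
    · rw [Walk.length_reverse]; grind
    · simpa using fun z hz => (hsupp z).1 (.inr hz)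
    · exact fun z hz => (hsupp z).1 (.inl hz)
    · simpa using fun e he => (hedges e).1 (.inr he)
  · refine ⟨p, q.reverse, hp, ?_, by simp [← hlen], ?_, ?_, ?_⟩
    · rw [Walk.length_reverse]; grind
    · exact fun z hz => (hsupp z).1 (.inl hz)
    · simpa using fun z hz => (hsupp z).1 (.inr hz)
    · exact fun e he => (hedges e).1 (.inl he)

/-- `k` is an odd closed walk in the vertex set `A`, of least possible length; such a walk is a
chordless cycle. -/
structure IsShortestOddIn (A : Set V) (k : G.Walk a a) : Prop where
  odd : Odd k.length
  subset : ∀ z ∈ k.support, z ∈ A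
  length_le : ∀ {b : V} (k' : G.Walk b b), Odd k'.length → (∀ z ∈ k'.support, z ∈ A) →
    k.length ≤ k'.length

/-- The vertices through which a shortest odd closed walk in `A` passes. -/
def shortestOddBases (G : SimpleGraph V) (A : Set V) : Set V :=
  {a | ∃ k : G.Walk a a, IsShortestOddIn A k}

lemma exists_mem_shortestOddBases (k : G.Walk a a) (hk : Odd k.length)
    (hA : ∀ z ∈ k.support, z ∈ A) : ∃ b ∈ A, b ∈ shortestOddBases G A := by
  obtain ⟨⟨b, l⟩, ⟨hl, hlA⟩, hmin⟩ := exists_minimalFor_of_wellFoundedLT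
    (fun k : Σ a, G.Walk a a => Odd k.2.length ∧ ∀ z ∈ k.2.support, z ∈ A)
    (fun k => k.2.length) ⟨⟨a, k⟩, hk, hA⟩
  refine ⟨b, hlA b l.start_mem_support, l, hl, hlA, fun k' hk' hk'A => ?_⟩
  exact le_of_not_gt fun h => h.not_ge (hmin (j := ⟨_, k'⟩) ⟨hk', hk'A⟩ h.le)

namespace IsShortestOddIn

variable {k : G.Walk a a}

lemma mem_shortestOddBases (h : IsShortestOddIn A k) (hs : s ∈ k.support) :
    s ∈ shortestOddBases G A := by
  classical
  refine ⟨k.rotate s hs, ?_, fun z hz => h.subset z ((k.mem_support_rotate_iff s hs).1 hz), ?_⟩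
  · rw [k.length_rotate]; exact h.odd
  · rw [k.length_rotate]; exact h.length_le

lemma mem_edges_of_adj (h : IsShortestOddIn A k) (hs : s ∈ k.support) (ht : t ∈ k.support)
    (hst : G.Adj s t) : s(s, t) ∈ k.edges := by
  obtain ⟨p, q, hp, hq, hlen, -, hqk, hpk⟩ := exists_odd_even_walk h.odd hs ht
  have hle := h.length_le (q.concat hst.symm) (by rw [Walk.length_concat]; exact hq.add_one) (by
    simp only [Walk.support_concat, List.mem_append, List.mem_singleton]
    rintro z (hz | rfl)
    exacts [h.subset z (hqk z hz), h.subset _ hs])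
  rw [Walk.length_concat] at hle
  exact hpk _ (mem_edges_of_length_eq_one p (by have := hp.pos; omega))

lemma isCycle (h : IsShortestOddIn A k) : k.IsCycle := by
  refine isCycle_of_odd (by_contra fun hk => ?_) h.odd
  obtain ⟨x, p, c, q, rfl, hp, hc, -⟩ := exists_closed_decomposition h.odd.pos hk
  have hodd := h.odd
  simp only [Walk.length_append] at hodd
  rcases Nat.even_or_odd c.length with hceven | hcodd
  · have hle := h.length_le (p.append q) (by rw [Walk.length_append]; grind)
      fun z hz => h.subset z (by simp only [Walk.mem_support_append_iff] at hz ⊢; tauto)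
    simp only [Walk.length_append] at hle
    omega
  · have hle := h.length_le c hcodd fun z hz => h.subset z (by simp [hz])
    simp only [Walk.length_append] at hle
    omega

lemma mem_shortestOddBases_of_adj_adj (h : IsShortestOddIn A k) (hx : x ∈ k.support)
    (hy : y ∈ k.support) (hxy : x ≠ y) (hs : s ∈ A) (hsx : G.Adj s x) (hsy : G.Adj s y) :
    s ∈ shortestOddBases G A := by
  obtain ⟨p, q, hp, hq, hlen, hpk, -, -⟩ := exists_odd_even_walk h.odd hx hy
  have hqpos := length_pos_of_ne q hxy
  refine ⟨.cons hsx (p.concat hsy.symm), ?_, ?_, fun k' hk' hk'A => ?_⟩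
  · simpa using hp.add_one.add_one
  · simp only [Walk.support_cons, Walk.support_concat, List.mem_cons, List.mem_append,
      List.not_mem_nil, or_false]
    rintro z (rfl | hz | rfl)
    exacts [hs, h.subset z (hpk z hz), hs]
  · have hle := h.length_le k' hk' hk'A
    simp only [Walk.length_cons, Walk.length_concat]
    grind

end IsShortestOddIn

/-- `q` is a walk from `S` to `T` inside `U`, of least possible length. -/
structure IsShortestBetween (S T U : Set V) (q : G.Walk a b) : Prop where
  start_mem : a ∈ S
  end_mem : b ∈ T
  subset : ∀ z ∈ q.support, z ∈ U
  length_le : ∀ {a' b' : V} (q' : G.Walk a' b'), a' ∈ S → b' ∈ T → (∀ z ∈ q'.support, z ∈ U) →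
    q.length ≤ q'.length

lemma exists_isShortestBetween (p : G.Walk a b) (ha : a ∈ S) (hb : b ∈ T)
    (hp : ∀ z ∈ p.support, z ∈ U) :
    ∃ (a' b' : V) (q : G.Walk a' b'), IsShortestBetween S T U q := by
  obtain ⟨⟨a', b', q⟩, ⟨ha', hb', hq⟩, hmin⟩ := exists_minimalFor_of_wellFoundedLT
    (fun q : Σ a b, G.Walk a b => q.1 ∈ S ∧ q.2.1 ∈ T ∧ ∀ z ∈ q.2.2.support, z ∈ U)
    (fun q => q.2.2.length) ⟨⟨a, b, p⟩, ha, hb, hp⟩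
  refine ⟨a', b', q, ha', hb', hq, fun q' hS hT hU => ?_⟩
  exact le_of_not_gt fun h => h.not_ge (hmin (j := ⟨_, _, q'⟩) ⟨hS, hT, hU⟩ h.le)

namespace IsShortestBetween

variable {q : G.Walk a b}

lemma reverse (h : IsShortestBetween S T U q) : IsShortestBetween T S U q.reverse where
  start_mem := h.end_mem
  end_mem := h.start_mem
  subset := by simpa using h.subset
  length_le q' ha hb hU := by
    simpa using h.length_le q'.reverse hb ha (by simpa using hU)

lemma isPath (h : IsShortestBetween S T U q) : q.IsPath := by
  classical
  have hle := h.length_le q.bypass h.start_mem h.end_mem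
    fun z hz => h.subset z (q.support_bypass_subset_support hz)
  rw [← q.bypass_eq_self_of_length_le_length_bypass hle]
  exact q.bypass_isPath

lemma length_eq_one_of_adj {p : G.Walk a s} {m : G.Walk s t} {r : G.Walk t b}
    (h : IsShortestBetween S T U (p.append (m.append r))) (hst : G.Adj s t) : m.length = 1 := by
  have hle := h.length_le (p.append (.cons hst r)) h.start_mem h.end_mem fun z hz => h.subset z (by
    simp only [Walk.mem_support_append_iff, Walk.support_cons, List.mem_cons] at hz ⊢
    rcases hz with hz | rfl | hz
    exacts [.inl hz, .inl p.end_mem_support, .inr (.inr hz)])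
  simp only [Walk.length_append, Walk.length_cons] at hle
  have := length_pos_of_ne m hst.ne
  omega

lemma mem_edges_of_adj (h : IsShortestBetween S T U q) (hs : s ∈ q.support) (ht : t ∈ q.support)
    (hst : G.Adj s t) : s(s, t) ∈ q.edges := by
  obtain ⟨p₁, p₂, rfl⟩ := Walk.mem_support_iff_exists_append.1 hs
  rcases (Walk.mem_support_append_iff _ _).1 ht with ht | ht
  · obtain ⟨p, m, rfl⟩ := Walk.mem_support_iff_exists_append.1 ht
    rw [← Walk.append_assoc] at h
    have := mem_edges_of_length_eq_one m (h.length_eq_one_of_adj hst.symm)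
    rw [Sym2.eq_swap]
    simp [this]
  · obtain ⟨m, r, rfl⟩ := Walk.mem_support_iff_exists_append.1 ht
    simp [mem_edges_of_length_eq_one m (h.length_eq_one_of_adj hst)]

lemma eq_of_mem_left (h : IsShortestBetween S T U q) (hs : s ∈ q.support) (hsS : s ∈ S) :
    s = a := by
  obtain ⟨p₁, p₂, rfl⟩ := Walk.mem_support_iff_exists_append.1 hs
  have hle := h.length_le p₂ hsS h.end_mem fun z hz => h.subset z (by simp [hz])
  rw [Walk.length_append] at hle
  exact (Walk.eq_of_length_eq_zero (p := p₁) (by omega)).symm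

lemma mem_edges_of_adj_mem_left (h : IsShortestBetween S T U q) (hs : s ∈ q.support) (hsS : s ∉ S)
    (ht : t ∈ S) (htU : t ∈ U) (hst : G.Adj s t) : G.Adj a s ∧ s(a, s) ∈ q.edges := by
  obtain ⟨p₁, p₂, rfl⟩ := Walk.mem_support_iff_exists_append.1 hs
  have hle := h.length_le (.cons hst.symm p₂) ht h.end_mem fun z hz => by
    rcases List.mem_cons.1 hz with rfl | hz
    exacts [htU, h.subset z (by simp [hz])]
  simp only [Walk.length_append, Walk.length_cons] at hle
  have hpos := length_pos_of_ne p₁ (by rintro rfl; exact hsS h.start_mem)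
  have hone : p₁.length = 1 := by omega
  exact ⟨Walk.adj_of_length_eq_one hone, by simp [mem_edges_of_length_eq_one p₁ hone]⟩

end IsShortestBetween

/-- Within `U`, the set `A` can be left only through the vertex `x`. -/
def IsOnlyExit (G : SimpleGraph V) (U A : Set V) (x : V) : Prop :=
  ∀ z ∈ A, ∀ u ∈ U, u ∉ A → G.Adj z u → z = x

lemma IsShortestBetween.mem_edges_of_adj_mem_support {q : G.Walk a b} {k : G.Walk a a}
    (hq : IsShortestBetween (shortestOddBases G A) T U q) (hk : IsShortestOddIn A k) (hAU : A ⊆ U)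
    (hexit : IsOnlyExit G U A x) (hs : s ∈ q.support) (hsk : s ∉ k.support) (ht : t ∈ k.support)
    (hst : G.Adj s t) : s(s, t) ∈ q.edges := by
  have hsS : s ∉ shortestOddBases G A := fun h =>
    hsk (hq.eq_of_mem_left hs h ▸ k.start_mem_support)
  obtain ⟨has, hasq⟩ := hq.mem_edges_of_adj_mem_left hs hsS (hk.mem_shortestOddBases ht)
    (hAU (hk.subset t ht)) hst
  obtain rfl | hta := eq_or_ne t a
  · rwa [Sym2.eq_swap]
  have haA := hk.subset a k.start_mem_support
  have hsA : s ∈ A := by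
    by_contra hsA
    have hU := hq.subset s hs
    exact hta ((hexit t (hk.subset t ht) s hU hsA hst.symm).trans (hexit a haA s hU hsA has).symm)
  exact absurd (hk.mem_shortestOddBases_of_adj_adj k.start_mem_support ht hta.symm hsA has.symm hst)
    hsS

lemma IsShortestBetween.mem_edges_of_adj_of_mem_of_mem {q : G.Walk a b}
    (hq : IsShortestBetween S T U q) (hAU : A ⊆ U) (hBU : B ⊆ U) (hAB : Disjoint A B)
    (hx : IsOnlyExit G U A x) (hy : IsOnlyExit G U B y) (ha : a ∈ A) (hb : b ∈ B)
    (hsS : s ∈ S) (htT : t ∈ T) (hs : s ∈ A) (ht : t ∈ B) (hst : G.Adj s t) :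
    s(s, t) ∈ q.edges := by
  have hcross : ∀ s ∈ A, ∀ t ∈ B, G.Adj s t → s = x ∧ t = y := fun s hs t ht hst =>
    ⟨hx s hs t (hBU ht) (Set.disjoint_right.1 hAB ht) hst,
      hy t ht s (hAU hs) (Set.disjoint_left.1 hAB hs) hst.symm⟩
  have hle := hq.length_le (.cons hst .nil) hsS htT (by
    simpa using ⟨hAU hs, hBU ht⟩)
  have hpos := length_pos_of_ne q (hAB.ne_of_mem ha hb)
  have hone : q.length = 1 := le_antisymm (by simpa using hle) hpos
  obtain ⟨rfl, rfl⟩ := hcross s hs t ht hst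
  obtain ⟨rfl, rfl⟩ := hcross a ha b hb (Walk.adj_of_length_eq_one hone)
  exact mem_edges_of_length_eq_one q hone

lemma IsShortestBetween.not_satisfiesSharp {q : G.Walk a b}
    (hq : IsShortestBetween (shortestOddBases G A) (shortestOddBases G B) U q) (hAU : A ⊆ U)
    (hBU : B ⊆ U) (hAB : Disjoint A B) (hx : IsOnlyExit G U A x) (hy : IsOnlyExit G U B y) :
    ¬ SatisfiesSharp G := by
  obtain ⟨k, hk⟩ := hq.start_mem
  obtain ⟨l, hl⟩ := hq.end_mem
  have haA := hk.subset a k.start_mem_support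
  have hbB := hl.subset b l.start_mem_support
  have hkq : ∀ s ∈ q.support, ∀ t ∈ k.support, G.Adj s t → s(s, t) ∈ k.edges ∨ s(s, t) ∈ q.edges :=
    fun s hs t ht hst => (em (s ∈ k.support)).imp (fun hsk => hk.mem_edges_of_adj hsk ht hst)
      fun hsk => hq.mem_edges_of_adj_mem_support hk hAU hx hs hsk ht hst
  have hlq : ∀ s ∈ q.support, ∀ t ∈ l.support, G.Adj s t → s(s, t) ∈ l.edges ∨ s(s, t) ∈ q.edges :=
    fun s hs t ht hst => (em (s ∈ l.support)).imp (fun hsl => hl.mem_edges_of_adj hsl ht hst)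
      fun hsl => by
        simpa using hq.reverse.mem_edges_of_adj_mem_support hl hBU hy (by simpa) hsl ht hst
  have hkl : ∀ s ∈ k.support, ∀ t ∈ l.support, G.Adj s t → s(s, t) ∈ q.edges :=
    fun s hs t ht hst => hq.mem_edges_of_adj_of_mem_of_mem hAU hBU hAB hx hy haA hbB
      (hk.mem_shortestOddBases hs) (hl.mem_shortestOddBases ht) (hk.subset s hs) (hl.subset t ht)
      hst
  refine not_not_intro ⟨a, b, k, l, q, hk.isCycle, hk.odd, hl.isCycle, hl.odd, hq.isPath,
    length_pos_of_ne q (hAB.ne_of_mem haA hbB),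
    fun z hz hz' => Set.disjoint_left.1 hAB (hk.subset z hz) (hl.subset z hz'),
    fun z hz hzk => hq.eq_of_mem_left hz (hk.mem_shortestOddBases hzk),
    fun z hz hzl => hq.reverse.eq_of_mem_left (by simpa) (hl.mem_shortestOddBases hzl), ?_⟩
  rintro s t (hs | hs | hs) (ht | ht | ht) hst
  · exact .inl (hk.mem_edges_of_adj hs ht hst)
  · exact .inr (.inr (hkl s hs t ht hst))
  · exact (Sym2.eq_swap ▸ hkq t ht s hs hst.symm).imp_right .inr
  · exact .inr (.inr (Sym2.eq_swap ▸ hkl t ht s hs hst.symm))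
  · exact .inr (.inl (hl.mem_edges_of_adj hs ht hst))
  · exact .inr (Sym2.eq_swap ▸ hlq t ht s hs hst.symm)
  · exact (hkq s hs t ht hst).imp_right .inr
  · exact .inr (hlq s hs t ht hst)
  · exact .inr (.inr (hq.mem_edges_of_adj hs ht hst))

/-- The forbidden induced subgraph consists of shortest odd closed walks inside `c` and `c'`, chosen
with their distance in `U` least possible, and of a shortest walk between them. -/
lemma not_satisfiesSharp {c : G.Walk x x} {c' : G.Walk y y} {p : G.Walk x y} (hc : Odd c.length)
    (hc' : Odd c'.length) (hcU : {z | z ∈ c.support} ⊆ U) (hcU' : {z | z ∈ c'.support} ⊆ U)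
    (hpU : ∀ z ∈ p.support, z ∈ U) (hdisj : Disjoint {z | z ∈ c.support} {z | z ∈ c'.support})
    (hx : IsOnlyExit G U {z | z ∈ c.support} x) (hy : IsOnlyExit G U {z | z ∈ c'.support} y) :
    ¬ SatisfiesSharp G := by
  obtain ⟨a, hac, ha⟩ := exists_mem_shortestOddBases (A := {z | z ∈ c.support}) c hc fun _ => id
  obtain ⟨b, hbc, hb⟩ := exists_mem_shortestOddBases (A := {z | z ∈ c'.support}) c' hc' fun _ => id
  obtain ⟨c₁, c₂, hc₁₂⟩ := Walk.mem_support_iff_exists_append.1 hac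
  obtain ⟨d₁, d₂, hd₁₂⟩ := Walk.mem_support_iff_exists_append.1 hbc
  obtain ⟨_, _, q, hq⟩ := exists_isShortestBetween (c₂.append (p.append d₁)) ha hb (U := U) (by
    simp only [Walk.mem_support_append_iff]
    rintro z (hz | hz | hz)
    exacts [hcU (by simp [hc₁₂, hz]), hpU z hz, hcU' (by simp [hd₁₂, hz])])
  exact hq.not_satisfiesSharp hcU hcU' hdisj hx hy

end Shortest

section Dichotomy

variable {V : Type*} {G : SimpleGraph V} {a x y : V} {m n : G.edgeSet →₀ ℕ}

/-- An even cycle, or two odd cycles with exactly one common vertex traversed one after the other: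
the walks whose binomials are the circuits appearing in this argument. -/
def IsCircuitWalk (w : G.Walk a a) : Prop :=
  (w.IsCycle ∧ Even w.length) ∨ ∃ c q : G.Walk a a, w = c.append q ∧ c.IsCycle ∧ q.IsCycle ∧
    Odd c.length ∧ Odd q.length ∧ ∀ z ∈ c.support, z ∈ q.support → z = a

lemma IsCircuitWalk.even {w : G.Walk a a} (h : IsCircuitWalk w) : Even w.length := by
  rcases h with ⟨-, heven⟩ | ⟨c, q, rfl, -, -, hc, hq, -⟩
  · exact heven
  · rw [Walk.length_append]
    exact hc.add_odd hq

lemma IsCircuitWalk.reverse {w : G.Walk a a} (h : IsCircuitWalk w) : IsCircuitWalk w.reverse := by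
  rcases h with ⟨hw, heven⟩ | ⟨c, q, rfl, hc, hq, hcodd, hqodd, hcq⟩
  · exact .inl ⟨hw.reverse, by simpa⟩
  · exact .inr ⟨q.reverse, c.reverse, Walk.reverse_append _ _, hq.reverse, hc.reverse, by simpa,
      by simpa, by simpa using fun z hz hz' => hcq z hz' hz⟩

/-- A pair of monomials coming from an even cycle or from two odd cycles with one common vertex. -/
def IsCircuitPair (m n : G.edgeSet →₀ ℕ) : Prop :=
  ∃ (a : V) (w : G.Walk a a), IsCircuitWalk w ∧ walkPlus w = m ∧ walkMinus w = n

lemma IsCircuitPair.symm (h : IsCircuitPair m n) : IsCircuitPair n m := by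
  obtain ⟨a, w, hw, rfl, rfl⟩ := h
  exact ⟨a, w.reverse, hw.reverse, by rw [walkPlus_reverse, if_pos hw.even],
    by rw [walkMinus_reverse, if_pos hw.even]⟩

lemma three_le_length_of_disjoint {w : G.Walk a a} (heven : Even w.length) (hpos : 0 < w.length)
    (hdisj : Disjoint (walkPlus w) (walkMinus w)) : 3 ≤ w.length := by
  by_contra hlt
  match w with
  | .nil => simp at hpos
  | .cons _ .nil => simp at heven
  | .cons h (.cons h' .nil) =>
    simp only [walkPlus_cons, walkMinus_cons, walkPlus_nil, walkMinus_nil, add_zero,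
      edgeExp_symm h, disjoint_self] at hdisj
    exact edgeExp_ne_zero h hdisj
  | .cons _ (.cons _ (.cons _ _)) => simp at hlt

lemma IsPrimitiveWalk.ne_of_two_returns {c : G.Walk x x} {p : G.Walk x y} {d : G.Walk y y}
    {r : G.Walk y x} (hw : IsPrimitiveWalk (c.append (p.append (d.append r)))) (hc : 0 < c.length)
    (hp : 0 < p.length) (hd : 0 < d.length) : x ≠ y := by
  rintro rfl
  have hcodd : Odd c.length := hw.odd_left hc (by simp; omega)
  have hpodd : Odd p.length := by
    have h := hw.rotate
    rw [← Walk.append_assoc] at h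
    exact h.odd_left hp (by simp; omega)
  have hcpodd : Odd (c.append p).length := by
    rw [Walk.append_assoc] at hw
    exact hw.odd_left (by simp; omega) (by simp; omega)
  rw [Walk.length_append] at hcpodd
  exact Nat.not_even_iff_odd.2 hcpodd (hcodd.add_odd hpodd)

lemma IsPrimitiveWalk.isOnlyExit {c q : G.Walk x x} (hw : IsPrimitiveWalk (c.append q))
    (hc : c.IsCycle) (hq : 0 < q.length)
    (hsplit : ¬ IsSplit (endpoints G) (walkPlus (c.append q)) (walkMinus (c.append q))) :
    IsOnlyExit G {z | z ∈ (c.append q).support} {z | z ∈ c.support} x := by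
  intro z hz u hu huc hzu
  by_contra hzx
  refine hsplit (hw.isSplit_of_chord hc hq hz ?_ hzx ?_ hzu)
  · exact ((Walk.mem_support_append_iff _ _).1 hu).resolve_left huc
  · rintro rfl
    exact huc c.start_mem_support

lemma IsPrimitiveWalk.isSplit_of_linkage (hsharp : SatisfiesSharp G) {c : G.Walk x x}
    {p : G.Walk x y} {d : G.Walk y y} {r : G.Walk y x}
    (hw : IsPrimitiveWalk (c.append (p.append (d.append r)))) (hc : c.IsCycle) (hd : d.IsCycle)
    (hp : 0 < p.length) :
    IsSplit (endpoints G) (walkPlus (c.append (p.append (d.append r))))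
      (walkMinus (c.append (p.append (d.append r)))) := by
  by_contra hsplit
  have hc0 : 0 < c.length := by have := hc.three_le_length; omega
  have hd0 : 0 < d.length := by have := hd.three_le_length; omega
  have hxy := hw.ne_of_two_returns hc0 hp hd0
  have hrot : walkPair (c.append (p.append (d.append r))) =
      walkPair (d.append (r.append (c.append p))) := by
    have heven := hw.1
    rw [Walk.append_assoc] at heven ⊢
    rw [Walk.append_assoc d]
    exact walkPair_rotate _ _ heven
  have hw' := hw.of_walkPair_eq hrot
  have hsplit' := mt (rel_of_walkPair_eq (r := IsSplit (endpoints G)) .symm hrot.symm) hsplit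
  have hsupp : {z | z ∈ (d.append (r.append (c.append p))).support} =
      {z | z ∈ (c.append (p.append (d.append r))).support} := by
    ext z
    simp only [Set.mem_ofPred_eq, Walk.mem_support_append_iff]
    tauto
  have hdisj : Disjoint {z | z ∈ c.support} {z | z ∈ d.support} :=
    Set.disjoint_left.2 fun z hzc hzd => hxy <|
      (hw.eq_of_mem_support hzc (by simp [show z ∈ d.support from hzd])).symm.trans
        (hw'.eq_of_mem_support hzd (by simp [show z ∈ c.support from hzc]))
  refine not_satisfiesSharp (p := p) (hw.odd_left hc0 (by simp; omega))
    (hw'.odd_left hd0 (by simp; omega)) ?_ ?_ ?_ hdisj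
    (hw.isOnlyExit hc (by simp; omega) hsplit)
    (hsupp ▸ hw'.isOnlyExit hd (by simp; omega) hsplit') hsharp
  all_goals
    intro z hz
    simp only [Set.mem_ofPred_eq, Walk.mem_support_append_iff] at hz ⊢
    tauto

lemma IsPrimitiveWalk.isCircuitPair_or_isSplit (hsharp : SatisfiesSharp G) {w : G.Walk a a}
    (hw : IsPrimitiveWalk w) (hdisj : Disjoint (walkPlus w) (walkMinus w)) :
    IsCircuitPair (walkPlus w) (walkMinus w) ∨
      IsSplit (endpoints G) (walkPlus w) (walkMinus w) := by
  by_cases hnodup : w.support.tail.Nodup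
  · exact .inl ⟨a, w, .inl ⟨isCycle_of_nodup hnodup
      (three_le_length_of_disjoint hw.1 hw.length_pos hdisj), hw.1⟩, rfl, rfl⟩
  obtain ⟨x, p, c, r, rfl, hp, hc0, hcnodup⟩ := exists_closed_decomposition hw.length_pos hnodup
  have hrot : walkPair (c.append (r.append p)) = walkPair (p.append (c.append r)) := by
    rw [walkPair_rotate p _ hw.1, Walk.append_assoc]
  refine rel_of_walkPair_eq (r := fun m n => IsCircuitPair m n ∨ IsSplit (endpoints G) m n)
    (.imp .symm .symm) hrot ?_
  replace hw := hw.of_walkPair_eq hrot.symm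
  have hq0 : 0 < (r.append p).length := by simp; omega
  generalize r.append p = q at hw hq0
  have hcodd := hw.odd_left hc0 hq0
  have hqodd := hw.odd_right hc0 hq0
  have hc := isCycle_of_odd hcnodup hcodd
  by_cases hqnodup : q.support.tail.Nodup
  · exact .inl ⟨x, _, .inr ⟨c, q, rfl, hc, isCycle_of_odd hqnodup hqodd, hcodd, hqodd,
      fun z => hw.eq_of_mem_support⟩, rfl, rfl⟩
  obtain ⟨y, p, d, r, rfl, hp, hd0, hdnodup⟩ := exists_closed_decomposition hq0 hqnodup
  have hdodd : Odd d.length := by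
    have h := hw
    rw [Walk.append_assoc] at h
    have h' := h.rotate
    rw [← Walk.append_assoc] at h'
    exact h'.odd_left hd0 (by simp; omega)
  exact .inr (hw.isSplit_of_linkage hsharp hc (isCycle_of_odd hdnodup hdodd) hp)

lemma eq_of_le_of_endpoints_eq (h : m ≤ n) (hD : endpoints G m = endpoints G n) : m = n := by
  obtain ⟨k, rfl⟩ := le_iff_exists_add.1 h
  rw [map_add, left_eq_add, endpoints_eq_zero] at hD
  rw [hD, add_zero]

lemma isCircuitPair_or_isSplit (hsharp : SatisfiesSharp G) (hD : endpoints G m = endpoints G n)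
    (hm : m ≠ 0) (hdisj : Disjoint m n) : IsCircuitPair m n ∨ IsSplit (endpoints G) m n := by
  obtain ⟨m', hm', n', hn', hprim⟩ := exists_isPrimitivePair_le hD hm
  have hD' : endpoints G m' = endpoints G n' := hprim.1.1
  obtain rfl | hne := eq_or_ne m' m
  · obtain rfl := eq_of_le_of_endpoints_eq hn' (hD'.symm.trans hD)
    obtain ⟨a, w, hw, rfl, rfl⟩ := hprim.exists_walk
    exact hw.isCircuitPair_or_isSplit hsharp hdisj
  · obtain ⟨m₂, rfl⟩ := le_iff_exists_add.1 hm'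
    obtain ⟨n₂, rfl⟩ := le_iff_exists_add.1 hn'
    refine .inr ⟨0, m', m₂, n', n₂, rfl, rfl, by rw [hD', add_zero], ?_, by simpa using hne, ?_,
      .inl rfl⟩
    · rw [map_add, map_add, hD'] at hD
      rw [add_zero]
      exact add_left_cancel hD
    · rintro rfl
      rw [map_zero, endpoints_eq_zero] at hD'
      exact hprim.1.2 (Prod.ext hD' rfl)

lemma isCircuitPair_of_not_linked (hsharp : SatisfiesSharp G) (hD : endpoints G m = endpoints G n)
    (h : ¬ Linked (endpoints G) m n) : IsCircuitPair m n := by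
  have hm : m ≠ 0 := (preservesDegree_endpoints G).ne_zero hD fun hmn => h (hmn ▸ .refl m)
  exact (isCircuitPair_or_isSplit hsharp hD hm (disjoint_of_not_linked hD h)).resolve_right
    fun hs => h hs.linked

lemma IsCircuitWalk.length_pos {w : G.Walk a a} (h : IsCircuitWalk w) : 0 < w.length := by
  rcases h with ⟨hw, -⟩ | ⟨c, q, rfl, hc, -⟩
  · have := hw.three_le_length
    omega
  · have := hc.three_le_length
    rw [Walk.length_append]
    omega

lemma IsCircuitWalk.edges_nodup {w : G.Walk a a} (h : IsCircuitWalk w) : w.edges.Nodup := by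
  rcases h with ⟨hw, -⟩ | ⟨c, q, rfl, hc, hq, -, -, hcq⟩
  · exact hw.edges_nodup
  · rw [Walk.edges_append]
    exact hc.edges_nodup.append hq.edges_nodup (edges_disjoint_of_support hcq)

lemma IsCircuitWalk.add_le_one {w : G.Walk a a} (h : IsCircuitWalk w) (e : G.edgeSet) :
    walkPlus w e + walkMinus w e ≤ 1 := by
  classical
  rw [walkPlus_add_walkMinus_apply]
  exact List.nodup_iff_count_le_one.1 h.edges_nodup _

lemma IsCircuitPair.isSquarefreeExp (h : IsCircuitPair m n) : IsSquarefreeExp m := by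
  obtain ⟨a, w, hw, rfl, rfl⟩ := h
  exact fun e => le_self_add.trans (hw.add_le_one e)

lemma SatisfiesSharp.squarefreeOrSplit (hsharp : SatisfiesSharp G) :
    SquarefreeOrSplit (endpoints G) := fun _ _ hD hm hdisj =>
  (isCircuitPair_or_isSplit hsharp hD hm hdisj).imp_left fun h =>
    ⟨h.isSquarefreeExp, h.symm.isSquarefreeExp⟩

end Dichotomy

/-! ### Circuits of the edge configuration -/

section Circuits

variable {V : Type*} {G : SimpleGraph V} {a b x : V}

/-- The integer vector with entries alternately `1` and `-1` along the edges of a walk, whose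
binomial is the one of the walk when no edge is repeated. -/
noncomputable def walkVector (w : G.Walk a b) : G.edgeSet → ℤ :=
  fun e => walkPlus w e - walkMinus w e

lemma walkVector_eq_zero {w : G.Walk a b} {e : G.edgeSet} (h : (e : Sym2 V) ∉ w.edges) :
    walkVector w e = 0 := by
  simp only [mem_edges_iff, not_or, not_not] at h
  simp [walkVector, h]

lemma walkVector_append_of_odd {c q : G.Walk x x} (hc : Odd c.length) :
    walkVector (c.append q) = walkVector c - walkVector q := by
  ext e
  simp only [walkVector, walkPlus_append_of_odd hc, walkMinus_append_of_odd hc, Finsupp.add_apply,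
    Pi.sub_apply]
  push_cast
  ring

lemma alternating_of_consecutive {f : G.edgeSet → ℤ} (p : G.Walk a b)
    (hf : ∀ (s y t : V) (p₁ : G.Walk a s) (h : G.Adj s y) (h' : G.Adj y t) (p₂ : G.Walk t b),
      p = p₁.append (.cons h (.cons h' p₂)) → f ⟨s(s, y), h⟩ + f ⟨s(y, t), h'⟩ = 0) :
    ∃ α : ℤ, ∀ e, (walkPlus p e ≠ 0 → f e = α) ∧ (walkMinus p e ≠ 0 → f e = -α) := by
  induction p with
  | nil => simp
  | @cons u v w h p ih =>
    obtain ⟨α, hα⟩ := ih fun s y t p₁ h₁ h₂ p₂ hp => hf s y t (.cons h p₁) h₁ h₂ p₂ (by simp [hp])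
    suffices hfirst : ∃ β, f ⟨s(u, v), h⟩ = β ∧
        ∀ e, (walkPlus p e ≠ 0 → f e = -β) ∧ (walkMinus p e ≠ 0 → f e = β) by
      obtain ⟨β, hβ, hp⟩ := hfirst
      refine ⟨β, fun e => ⟨fun he => ?_, by simpa using (hp e).1⟩⟩
      obtain rfl | hne := eq_or_ne e ⟨s(u, v), h⟩
      · exact hβ
      · exact (hp e).2 (by simpa [edgeExp, hne.symm] using he)
    cases p with
    | nil => exact ⟨_, rfl, by simp⟩
    | @cons _ t _ h' r =>
      have hnext : f ⟨s(v, t), h'⟩ = α := (hα _).1 (by simp [edgeExp])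
      refine ⟨-α, ?_, by simpa using hα⟩
      linarith [hf _ _ _ .nil h h' r rfl]

lemma consecutive_edges_of_isCycle {s y t : V} {p₁ : G.Walk x s} {h : G.Adj s y} {h' : G.Adj y t}
    {p₂ : G.Walk t x} (hc : (p₁.append (.cons h (.cons h' p₂))).IsCycle) :
    y ≠ x ∧ (⟨s(s, y), h⟩ : G.edgeSet) ≠ ⟨s(y, t), h'⟩ ∧
      ∀ e : G.edgeSet, y ∈ (e : Sym2 V) → (e : Sym2 V) ∈ (p₁.append (.cons h (.cons h' p₂))).edges →
        e = ⟨s(s, y), h⟩ ∨ e = ⟨s(y, t), h'⟩ := by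
  have hnd := hc.support_nodup
  simp only [Walk.tail_support_append, Walk.support_cons, List.tail_cons] at hnd
  obtain ⟨-, hnd, hdisj⟩ := List.nodup_append'.1 hnd
  have hp₂ : y ∉ p₂.support := (List.nodup_cons.1 hnd).1
  have hyx : y ≠ x := fun hyx => hp₂ (hyx ▸ p₂.end_mem_support)
  have hp₁ : y ∉ p₁.support := by
    rw [← p₁.cons_tail_support, List.mem_cons, not_or]
    exact ⟨hyx, fun hy => hdisj hy List.mem_cons_self⟩
  refine ⟨hyx, fun heq => ?_, fun e hy he => ?_⟩
  · have hst : s(s, y) = s(y, t) := congrArg Subtype.val heq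
    have hed := hc.edges_nodup
    simp [Walk.edges_append, List.nodup_append, hst] at hed
  · have hmem {u v : V} (p : G.Walk u v) : (e : Sym2 V) ∈ p.edges → y ∈ p.support := fun he =>
      Walk.mem_support_iff_exists_mem_edges.2 (.inr ⟨e, he, hy⟩)
    simp only [Walk.edges_append, Walk.edges_cons, List.mem_append, List.mem_cons] at he
    rcases he with he | he | he | he
    · exact absurd (hmem p₁ he) hp₁
    · exact .inl (Subtype.ext he)
    · exact .inr (Subtype.ext he)
    · exact absurd (hmem p₂ he) hp₂

lemma eq_add_smul_walkVector {c q : G.Walk x x} {f : G.edgeSet → ℤ} {α β : ℤ}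
    (hcq : c.edges.Disjoint q.edges)
    (hs : ∀ e, f e ≠ 0 → (e : Sym2 V) ∈ c.edges ∨ (e : Sym2 V) ∈ q.edges)
    (hα : ∀ e : G.edgeSet, (e : Sym2 V) ∈ c.edges → f e = α * walkVector c e)
    (hβ : ∀ e : G.edgeSet, (e : Sym2 V) ∈ q.edges → f e = β * walkVector q e) :
    f = α • walkVector c + β • walkVector q := by
  ext e
  simp only [Pi.add_apply, Pi.smul_apply, smul_eq_mul]
  by_cases hec : (e : Sym2 V) ∈ c.edges
  · rw [hα e hec, walkVector_eq_zero (hcq hec), mul_zero, add_zero]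
  · rw [walkVector_eq_zero hec, mul_zero, zero_add]
    by_cases heq : (e : Sym2 V) ∈ q.edges
    · exact hβ e heq
    · rw [walkVector_eq_zero heq, mul_zero]
      exact not_not.1 fun h => (hs e h).elim hec heq

variable [DecidableEq V] [Fintype G.edgeSet]

lemma sum_walkVector_smul (w : G.Walk a b) :
    ∑ e, walkVector w e • edgeVectors G e = configurationDegree (edgeVectors G) (walkPlus w) -
      configurationDegree (edgeVectors G) (walkMinus w) := by
  simp only [walkVector, sub_smul, Finset.sum_sub_distrib]
  rfl

lemma configurationDegree_edgeVectors (m : G.edgeSet →₀ ℕ) (y : V) :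
    configurationDegree (edgeVectors G) m y = (endpoints G m).count y := by
  have hcount : ∀ e : G.edgeSet, edgeVectors G e y = (e : Sym2 V).toMultiset.count y := by
    rintro ⟨⟨s, t⟩, h⟩
    have hst : s ≠ t := G.ne_of_adj h
    change (if y ∈ s(s, t) then (1 : ℤ) else 0) = (({s, t} : Multiset V).count y : ℤ)
    rw [Multiset.count_eq_of_nodup (by simpa using hst)]
    simp
  change (∑ e, (m e : ℤ) • edgeVectors G e) y = _
  rw [endpoints_apply, Finsupp.sum_fintype m (fun e n => n • (e : Sym2 V).toMultiset)
    fun _ => zero_smul ℕ _, Multiset.count_sum', Finset.sum_apply]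
  push_cast
  simp [hcount]

lemma configurationDegree_edgeVectors_eq_iff {m n : G.edgeSet →₀ ℕ} :
    configurationDegree (edgeVectors G) m = configurationDegree (edgeVectors G) n ↔
      endpoints G m = endpoints G n := by
  simp only [funext_iff, configurationDegree_edgeVectors, Nat.cast_inj, Multiset.ext]

lemma toricIdeal_edgeVectors_eq_fiberIdeal (K : Type*) [Field K] :
    toricIdeal K (edgeVectors G) = fiberIdeal K (endpoints G) :=
  (toricIdeal_eq_fiberIdeal _).trans
    (fiberIdeal_congr fun _ _ => configurationDegree_edgeVectors_eq_iff)

lemma sum_walkVector_smul_of_odd {c : G.Walk x x} (hc : Odd c.length) :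
    (∑ e, walkVector c e • edgeVectors G e) x = 2 := by
  rw [sum_walkVector_smul, Pi.sub_apply, configurationDegree_edgeVectors,
    configurationDegree_edgeVectors, endpoints_walkPlus_of_odd hc]
  simp only [Multiset.count_add, Multiset.count_singleton_self]
  push_cast
  ring

lemma alternating_on_cycle {f : G.edgeSet → ℤ} (hf : f ∈ kerZ (edgeVectors G)) {c : G.Walk x x}
    (hc : c.IsCycle) (hs : ∀ y ∈ c.support, y ≠ x → ∀ e : G.edgeSet, y ∈ (e : Sym2 V) → f e ≠ 0 →
      (e : Sym2 V) ∈ c.edges) :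
    ∃ α : ℤ, ∀ e : G.edgeSet, (e : Sym2 V) ∈ c.edges → f e = α * walkVector c e := by
  obtain ⟨α, hα⟩ : ∃ α : ℤ, ∀ e, (walkPlus c e ≠ 0 → f e = α) ∧ (walkMinus c e ≠ 0 → f e = -α) := by
    refine alternating_of_consecutive c ?_
    rintro s y t p₁ h h' p₂ rfl
    obtain ⟨hyx, hne, honly⟩ := consecutive_edges_of_isCycle hc
    have hsum : (∑ e, f e • edgeVectors G e) y = 0 := congrFun hf y
    rw [Finset.sum_apply, Fintype.sum_eq_add ⟨s(s, y), h⟩ ⟨s(y, t), h'⟩ hne] at hsum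
    · simpa [edgeVectors] using hsum
    · rintro e ⟨he, he'⟩
      by_contra hfe
      simp only [edgeVectors, Pi.smul_apply, smul_eq_mul, mul_ite, mul_one, mul_zero,
        ite_eq_right_iff, Classical.not_imp] at hfe
      exact (honly e hfe.1 (hs y (by simp) hyx e hfe.1 hfe.2)).elim he he'
  refine ⟨α, fun e he => ?_⟩
  have hone : walkPlus c e + walkMinus c e ≤ 1 := by
    rw [walkPlus_add_walkMinus_apply]
    exact List.nodup_iff_count_le_one.1 hc.edges_nodup _
  rcases (mem_edges_iff c e).1 he with h | h
  · rw [(hα e).1 h, walkVector, show walkPlus c e = 1 by omega, show walkMinus c e = 0 by omega]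
    simp
  · rw [(hα e).2 h, walkVector, show walkPlus c e = 0 by omega, show walkMinus c e = 1 by omega]
    simp

lemma IsCircuitWalk.eq_smul_walkVector {w : G.Walk a a} (hw : IsCircuitWalk w) {f : G.edgeSet → ℤ}
    (hf : f ∈ kerZ (edgeVectors G)) (hs : ∀ e, f e ≠ 0 → (e : Sym2 V) ∈ w.edges) :
    ∃ α : ℤ, f = α • walkVector w := by
  rcases hw with ⟨hw, -⟩ | ⟨c, q, rfl, hc, hq, hcodd, hqodd, hcq⟩
  · obtain ⟨α, hα⟩ := alternating_on_cycle hf hw fun _ _ _ e _ => hs e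
    refine ⟨α, funext fun e => ?_⟩
    by_cases he : (e : Sym2 V) ∈ w.edges
    · exact hα e he
    · rw [Pi.smul_apply, walkVector_eq_zero he, smul_zero]
      exact not_not.1 (mt (hs e) he)
  have hmem {y : V} {e : G.edgeSet} (hy : y ∈ (e : Sym2 V)) (p : G.Walk a a)
      (he : (e : Sym2 V) ∈ p.edges) : y ∈ p.support :=
    Walk.mem_support_iff_exists_mem_edges.2 (.inr ⟨e, he, hy⟩)
  simp only [Walk.edges_append, List.mem_append] at hs
  obtain ⟨α, hα⟩ := alternating_on_cycle hf hc fun y hy hya e hye hfe =>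
    (hs e hfe).resolve_right fun he => hya (hcq y hy (hmem hye q he))
  obtain ⟨β, hβ⟩ := alternating_on_cycle hf hq fun y hy hya e hye hfe =>
    (hs e hfe).resolve_left fun he => hya (hcq y (hmem hye c he) hy)
  have hsum := eq_add_smul_walkVector (edges_disjoint_of_support hcq) hs hα hβ
  have hβα : 2 * α + 2 * β = 0 := by
    have hf0 : ∑ e, f e • edgeVectors G e = 0 := hf
    have h0 := congrFun hf0 a
    simp only [hsum, Pi.add_apply, Pi.smul_apply, add_smul, smul_assoc, Finset.sum_add_distrib,
      ← Finset.smul_sum] at h0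
    rw [sum_walkVector_smul_of_odd hcodd, sum_walkVector_smul_of_odd hqodd] at h0
    simpa [mul_comm] using h0
  refine ⟨α, ?_⟩
  rw [hsum, walkVector_append_of_odd hcodd, smul_sub, sub_eq_add_neg, ← neg_smul,
    show β = -α by linarith]

lemma IsCircuitWalk.isCircuitVector {w : G.Walk a a} (hw : IsCircuitWalk w) :
    IsCircuitVector (edgeVectors G) (walkVector w) := by
  have hone (e) : walkPlus w e + walkMinus w e ≤ 1 := hw.add_le_one e
  obtain ⟨e₀, he₀⟩ := Finsupp.ne_iff.1 (walkPlus_ne_zero hw.length_pos)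
  have hval : walkVector w e₀ = 1 := by
    have := hone e₀
    simp only [Finsupp.coe_zero, Pi.zero_apply] at he₀
    simp only [walkVector]
    omega
  refine ⟨?_, fun h0 => ?_, fun f hf hf0 hss => ?_, ?_⟩
  · exact sub_mem_kerZ_iff.2
      (configurationDegree_edgeVectors_eq_iff.2 (endpoints_walkPlus_eq_walkMinus hw.even))
  · simp [h0] at hval
  · obtain ⟨α, rfl⟩ := hw.eq_smul_walkVector hf fun e he =>
      not_not.1 fun hew => hss.1 he (walkVector_eq_zero hew)
    have hα : α ≠ 0 := fun h => hf0 (by rw [h, zero_smul])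
    rw [Function.support_const_smul_of_ne_zero _ _ hα] at hss
    exact hss.ne rfl
  · refine Finset.normalize_gcd.symm.trans (normalize_eq_one.2 (isUnit_of_dvd_one ?_))
    exact hval ▸ Finset.gcd_dvd (Finset.mem_univ e₀)

lemma IsCircuitWalk.isCircuit (K : Type*) [Field K] {w : G.Walk a a} (hw : IsCircuitWalk w) :
    IsCircuit (edgeVectors G) (walkBinomial K w) := by
  have hone (e) : walkPlus w e + walkMinus w e ≤ 1 := hw.add_le_one e
  have hp : posExp (walkVector w) = walkPlus w := by
    ext e
    have := hone e
    simp only [posExp, walkVector, Finsupp.equivFunOnFinite_symm_apply_apply]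
    omega
  have hn : negExp (walkVector w) = walkMinus w := by
    ext e
    have := hone e
    simp only [negExp, walkVector, Finsupp.equivFunOnFinite_symm_apply_apply]
    omega
  exact ⟨_, hw.isCircuitVector, by rw [vecBinomial, hp, hn, walkBinomial]⟩

end Circuits

/-! ### Degrees with three unlinked monomials -/

section CompleteFour

variable {V : Type*} {G : SimpleGraph V} {a b c d : V} {m : G.edgeSet →₀ ℕ}

lemma exists_eq_edgeExp_add {S : Multiset V} (hm : endpoints G m = {a} + S) :
    ∃ (u : V) (h : G.Adj a u) (n : G.edgeSet →₀ ℕ),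
      m = edgeExp h + n ∧ {u} + endpoints G n = S := by
  obtain ⟨u, h, hle⟩ := exists_edgeExp_le_of_mem_endpoints (G := G) (m := m) (v := a) (by simp [hm])
  obtain ⟨n, rfl⟩ := le_iff_exists_add.1 hle
  rw [map_add, endpoints_edgeExp, add_assoc] at hm
  exact ⟨u, h, n, rfl, add_left_cancel hm⟩

lemma eq_edgeExp_of_endpoints_eq (h : G.Adj a b) (hm : endpoints G m = {a} + {b}) :
    m = edgeExp h := by
  obtain ⟨u, hu, n, rfl, hn⟩ := exists_eq_edgeExp_add hm
  obtain rfl : u = b := Multiset.mem_singleton.1 (hn ▸ by simp)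
  rw [add_eq_left, endpoints_eq_zero] at hn
  rw [hn, add_zero]

lemma eq_perfect_matching_of_endpoints_eq (hab : G.Adj a b) (hcd : G.Adj c d) (hac : G.Adj a c)
    (hbd : G.Adj b d) (had : G.Adj a d) (hbc : G.Adj b c)
    (hm : endpoints G m = {a} + {b} + ({c} + {d})) :
    m = edgeExp hab + edgeExp hcd ∨ m = edgeExp hac + edgeExp hbd ∨
      m = edgeExp had + edgeExp hbc := by
  rw [add_assoc] at hm
  obtain ⟨u, hu, n, rfl, hn⟩ := exists_eq_edgeExp_add hm
  have hmem : u ∈ ({b} + ({c} + {d}) : Multiset V) := hn ▸ by simp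
  simp only [Multiset.mem_add, Multiset.mem_singleton] at hmem
  rcases hmem with rfl | rfl | rfl
  · rw [eq_edgeExp_of_endpoints_eq hcd (add_left_cancel hn)]
    exact .inl rfl
  · rw [add_left_comm] at hn
    rw [eq_edgeExp_of_endpoints_eq hbd (add_left_cancel hn)]
    exact .inr (.inl rfl)
  · rw [add_comm, ← add_assoc] at hn
    rw [eq_edgeExp_of_endpoints_eq hbc (add_right_cancel hn)]
    exact .inr (.inr rfl)

end CompleteFour

section ThreeMonomials

variable {V : Type*} {G : SimpleGraph V} {a b s t y y' z u : V} {m n k : G.edgeSet →₀ ℕ}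

lemma exists_eq_cons_nil {p : G.Walk a b} (hp : Odd p.length) (h : walkMinus p = 0) :
    ∃ hab : G.Adj a b, p = .cons hab .nil := by
  cases p with
  | nil => simp at hp
  | cons hac p =>
    cases p with
    | nil => exact ⟨hac, rfl⟩
    | cons hcd p => simp [edgeExp_ne_zero] at h

lemma exists_walk_of_not_linked (hD : endpoints G m = endpoints G n)
    (h : ¬ Linked (endpoints G) m n) :
    ∃ (a : V) (w : G.Walk a a),
      Even w.length ∧ 0 < w.length ∧ walkPlus w = m ∧ walkMinus w = n := by
  have hm : m ≠ 0 := (preservesDegree_endpoints G).ne_zero hD fun hmn => h (hmn ▸ .refl m)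
  obtain ⟨a, w, heven, hpos, hwm, hwn⟩ := exists_alternating_closed_walk hD hm
  have hw := endpoints_walkPlus_eq_walkMinus heven
  obtain hwm' | hwm' := eq_or_ne (walkPlus w) m
  · exact ⟨a, w, heven, hpos, hwm', eq_of_le_of_endpoints_eq hwn (hw ▸ hwm' ▸ hD)⟩
  · obtain ⟨m₂, rfl⟩ := le_iff_exists_add.1 hwm
    obtain ⟨n₂, rfl⟩ := le_iff_exists_add.1 hwn
    have hD₂ : endpoints G m₂ = endpoints G n₂ := by
      rw [map_add, map_add, hw] at hD
      exact add_left_cancel hD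
    refine absurd (linked_of_exchange (g := 0) (by rwa [add_zero]) (by rwa [add_zero])
      (by simpa using hwm') fun h0 => ?_) h
    rw [h0, map_zero, endpoints_eq_zero] at hw
    exact walkPlus_ne_zero hpos hw

/-- The monomials of an even closed walk `w` and the monomial `k` form an unlinked triple. -/
def IsUnlinkedTripleWalk (k : G.edgeSet →₀ ℕ) (w : G.Walk a a) : Prop :=
  Even w.length ∧ IsUnlinkedTriple (endpoints G) (walkPlus w) (walkMinus w) k

namespace IsUnlinkedTripleWalk

lemma of_walkPair_eq {w : G.Walk a a} {w' : G.Walk b b} (hw : IsUnlinkedTripleWalk k w)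
    (h : walkPair w = walkPair w') : IsUnlinkedTripleWalk k w' :=
  ⟨length_eq_of_walkPair_eq h ▸ hw.1, rel_of_walkPair_eq
    (r := fun m n => IsUnlinkedTriple (endpoints G) m n k) IsUnlinkedTriple.swap h hw.2⟩

lemma notMem_edges {w : G.Walk a a} (hw : IsUnlinkedTripleWalk k w) (h : G.Adj z u)
    (hk : edgeExp h ≤ k) : s(z, u) ∉ w.edges := by
  intro hmem
  have edgeExp_le {n : G.edgeSet →₀ ℕ} (hn : n ⟨s(z, u), h⟩ ≠ 0) : edgeExp h ≤ n :=
    Finsupp.single_le_iff.2 (Nat.one_le_iff_ne_zero.2 hn)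
  rcases (mem_edges_iff w ⟨s(z, u), h⟩).1 hmem with hplus | hminus
  · exact hw.2.unlinked₁₃ (.of_le hw.2.map_eq₁₃ (edgeExp_ne_zero h) (edgeExp_le hplus) hk)
  · exact hw.2.unlinked₂₃ (.of_le hw.2.rotate.map_eq₁₂ (edgeExp_ne_zero h) (edgeExp_le hminus) hk)

lemma even_left {p : G.Walk z u} {q : G.Walk u z} (hw : IsUnlinkedTripleWalk k (p.append q))
    (h : G.Adj z u) (hk : edgeExp h ≤ k) : Even p.length := by
  by_contra hp
  rw [Nat.not_even_iff_odd] at hp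
  have hq : Odd q.length := by
    have := hw.1
    rw [Walk.length_append] at this
    grind
  have hnotMem := hw.notMem_edges h hk
  rw [Walk.edges_append, List.mem_append, not_or] at hnotMem
  have hp1 : p.length ≠ 1 := fun h1 => hnotMem.1 (mem_edges_of_length_eq_one p h1)
  have hq1 : q.length ≠ 1 := fun h1 =>
    hnotMem.2 (Sym2.eq_swap ▸ mem_edges_of_length_eq_one q h1)
  have := hp.pos
  have := hq.pos
  exact hw.2.unlinked₁₂ (linked_of_odd_chord hp hq (by omega) (by omega) h)

lemma exists_chord {w : G.Walk a a} (hw : IsUnlinkedTripleWalk k w) (hz : z ∈ w.support.tail) :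
    ∃ (u : V) (h : G.Adj z u), edgeExp h ≤ k ∧ u ∈ w.support := by
  have hsupport : endpoints G k = w.support.tail := by
    rw [← hw.2.map_eq₁₃, endpoints_walkPlus_eq_support_tail hw.1]
  obtain ⟨u, h, hle⟩ := exists_edgeExp_le_of_mem_endpoints (hsupport.symm ▸ Multiset.mem_coe.2 hz)
  refine ⟨u, h, hle, List.mem_of_mem_tail ?_⟩
  rw [← Multiset.mem_coe, ← hsupport]
  exact Multiset.mem_of_le (endpoints_mono hle) (by simp [endpoints_edgeExp])

section Crossing

variable {hsy : G.Adj s y} {p : G.Walk y t} {q : G.Walk t y'} {r : G.Walk y' s}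
  (hp : Odd p.length) (hq : Odd q.length)

include hp hq

lemma walkPlus_crossing : walkPlus ((Walk.cons hsy p).append (q.append r)) =
    edgeExp hsy + walkMinus p + (walkPlus q + walkMinus r) := by
  have hcons : Even (Walk.cons hsy p).length := by grind [Walk.length_cons]
  rw [walkPlus_append, if_pos hcons, walkPlus_cons, walkPlus_append_of_odd hq]

lemma walkMinus_crossing : walkMinus ((Walk.cons hsy p).append (q.append r)) =
    walkPlus p + (walkMinus q + walkPlus r) := by
  have hcons : Even (Walk.cons hsy p).length := by grind [Walk.length_cons]
  rw [walkMinus_append, if_pos hcons, walkMinus_cons, walkMinus_append_of_odd hq]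

variable (hw : IsUnlinkedTripleWalk k ((Walk.cons hsy p).append (q.append r)))
  (hst : G.Adj s t) (hstk : edgeExp hst ≤ k) (hyy' : G.Adj y y')

include hw hstk hyy'

-- Trading the plus edges of `q` and the edge `s y` for the chords `s t` and `y y'` and the minus
-- edges of `q` gives a monomial of the same degree which is linked to `k`.
lemma walkMinus_eq_zero_of_crossing : walkMinus p = 0 ∧ walkMinus q = 0 ∧ walkMinus r = 0 := by
  let middle := edgeExp hst + edgeExp hyy' + walkMinus p + walkMinus q + walkMinus r
  have hplus := walkPlus_crossing (hsy := hsy) (r := r) hp hq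
  have hminus := walkMinus_crossing (hsy := hsy) (r := r) hp hq
  have hmiddle : endpoints G (walkPlus ((Walk.cons hsy p).append (q.append r))) =
      endpoints G middle := by
    simp only [hplus, middle, map_add, endpoints_edgeExp, endpoints_walkPlus_of_odd hq]
    abel
  have hlinked : Linked (endpoints G) middle k :=
    .of_le (hmiddle.symm.trans hw.2.map_eq₁₃) (edgeExp_ne_zero hst)
      (by simp only [middle, add_assoc]; exact le_self_add) hstk
  have hdisj₁ := disjoint_of_not_linked hmiddle fun h => hw.2.unlinked₁₃ (h.trans hlinked)
  have hdisj₂ := disjoint_of_not_linked (hw.2.map_eq₁₂.symm.trans hmiddle) fun h =>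
    hw.2.unlinked₂₃ (h.trans hlinked)
  rw [hplus] at hdisj₁
  rw [hminus] at hdisj₂
  have hle : walkMinus p ≤ middle ∧ walkMinus q ≤ middle ∧ walkMinus r ≤ middle :=
    ⟨le_add_right (le_add_right le_add_self), le_add_right le_add_self, le_add_self⟩
  exact ⟨le_bot_iff.1 (hdisj₁ (le_add_right le_add_self) hle.1),
    le_bot_iff.1 (hdisj₂ (le_add_left le_self_add) hle.2.1),
    le_bot_iff.1 (hdisj₁ (le_add_left le_add_self) hle.2.2)⟩

lemma eq_of_crossing (hr : Odd r.length) (hn : endpoints G n = endpoints G k) :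
    n = walkPlus ((Walk.cons hsy p).append (q.append r)) ∨
      n = walkMinus ((Walk.cons hsy p).append (q.append r)) ∨ n = k := by
  obtain ⟨hp0, hq0, hr0⟩ := walkMinus_eq_zero_of_crossing hp hq hw hst hstk hyy'
  obtain ⟨hyt, rfl⟩ := exists_eq_cons_nil hp hp0
  obtain ⟨hty', rfl⟩ := exists_eq_cons_nil hq hq0
  obtain ⟨hy's, rfl⟩ := exists_eq_cons_nil hr hr0
  have hplus : walkPlus ((Walk.cons hsy (.cons hyt .nil)).append
      ((Walk.cons hty' .nil).append (.cons hy's .nil))) = edgeExp hsy + edgeExp hty' := by simp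
  have hminus : walkMinus ((Walk.cons hsy (.cons hyt .nil)).append
      ((Walk.cons hty' .nil).append (.cons hy's .nil))) = edgeExp hy's + edgeExp hyt := by
    simp [add_comm]
  obtain ⟨-, hw⟩ := hw
  rw [hplus, hminus] at hw ⊢
  have matchings {m : G.edgeSet →₀ ℕ} (hm : endpoints G m = endpoints G k) :
      m = edgeExp hsy + edgeExp hty' ∨ m = edgeExp hst + edgeExp hyy' ∨
        m = edgeExp hy's + edgeExp hyt := by
    rw [← edgeExp_symm hy's]
    refine eq_perfect_matching_of_endpoints_eq hsy hty' hst hyy' hy's.symm hyt ?_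
    rw [hm, ← hw.map_eq₁₃, map_add, endpoints_edgeExp, endpoints_edgeExp]
  have hk : k = edgeExp hst + edgeExp hyy' :=
    ((matchings rfl).resolve_left fun h => hw.unlinked₁₃ (h ▸ .refl _)).resolve_right fun h =>
      hw.unlinked₂₃ (h ▸ .refl _)
  rcases matchings hn with h | h | h
  · exact .inl h
  · exact .inr (.inr (h.trans hk.symm))
  · exact .inr (.inl h)

end Crossing

/-- A walk which, up to rotation, is a part of the closed walk `w`, and whose end points are joined
by an edge of the monomial `k`. -/
def IsChordArc (k : G.edgeSet →₀ ℕ) (w : G.Walk a a) (p : G.Walk s t) : Prop :=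
  ∃ (h : G.Adj s t) (q : G.Walk t s), edgeExp h ≤ k ∧ walkPair w = walkPair (p.append q)

lemma exists_shortest_isChordArc {w : G.Walk a a} (hw : IsUnlinkedTripleWalk k w)
    (hpos : 0 < w.length) :
    ∃ (s t : V) (p : G.Walk s t), IsChordArc k w p ∧
      ∀ (s' t' : V) (p' : G.Walk s' t'), IsChordArc k w p' → p.length ≤ p'.length := by
  let lengths : Set ℕ := {l | ∃ (s t : V) (p : G.Walk s t), IsChordArc k w p ∧ p.length = l}
  have hne : lengths.Nonempty := by
    obtain ⟨u, h, hle, hu⟩ := hw.exists_chord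
      (Walk.end_mem_tail_support (Walk.not_nil_iff_lt_length.2 hpos))
    obtain ⟨p, q, rfl⟩ := Walk.mem_support_iff_exists_append.1 hu
    exact ⟨_, a, u, p, ⟨h, q, hle, rfl⟩, rfl⟩
  obtain ⟨s, t, p, hp, hlength⟩ := Nat.sInf_mem hne
  exact ⟨s, t, p, hp, fun s' t' p' hp' => hlength ▸ Nat.sInf_le ⟨s', t', p', hp', rfl⟩⟩

lemma exists_crossing {w : G.Walk a a} (hw : IsUnlinkedTripleWalk k w) (hpos : 0 < w.length) :
    ∃ (s y t y' : V) (hsy : G.Adj s y) (p : G.Walk y t) (q : G.Walk t y') (r : G.Walk y' s)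
      (hst : G.Adj s t) (_ : G.Adj y y'),
      edgeExp hst ≤ k ∧ Odd p.length ∧ Odd q.length ∧ Odd r.length ∧
        walkPair w = walkPair ((Walk.cons hsy p).append (q.append r)) := by
  obtain ⟨s, t, p, ⟨hst, o, hstk, hpair⟩, hmin⟩ := hw.exists_shortest_isChordArc hpos
  cases p with
  | nil => exact absurd rfl hst.ne
  | @cons _ y _ hsy p =>
    have hw' := hw.of_walkPair_eq hpair
    have hrot : walkPair ((Walk.cons hsy p).append o) = walkPair (p.append (o.concat hsy)) := by
      rw [Walk.append_concat, Walk.concat_eq_append]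
      exact walkPair_rotate (.cons hsy .nil) (p.append o) hw'.1
    have hw'' := hw'.of_walkPair_eq hrot
    have hp : Odd p.length := by
      have := hw'.even_left hst hstk
      grind [Walk.length_cons]
    obtain ⟨y', hyy', hyy'k, hy'⟩ := hw'.exists_chord (z := y) (by simp)
    have hy's : y' ≠ s := by
      rintro rfl
      exact hw'.notMem_edges hyy' hyy'k (by simp [Sym2.eq_swap])
    have hy'p : y' ∉ p.support := by
      intro hmem
      obtain ⟨p₁, p₂, rfl⟩ := Walk.mem_support_iff_exists_append.1 hmem
      rw [← Walk.append_assoc] at hrot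
      have := hmin y y' p₁ ⟨hyy', _, hyy'k, hpair.trans hrot⟩
      rw [Walk.length_cons, Walk.length_append] at this
      omega
    have hy'o : y' ∈ o.support := by
      simpa [hy's, hy'p, Walk.mem_support_append_iff] using hy'
    obtain ⟨q, r, rfl⟩ := Walk.mem_support_iff_exists_append.1 hy'o
    have hq : Odd q.length := by
      rw [← Walk.append_concat, Walk.append_assoc] at hw''
      have := hw''.even_left hyy' hyy'k
      grind [Walk.length_append]
    have hr : Odd r.length := by
      have := hw'.1
      grind [Walk.length_append, Walk.length_cons]
    exact ⟨s, y, t, y', hsy, p, q, r, hst, hyy', hstk, hp, hq, hr, hpair⟩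

end IsUnlinkedTripleWalk

lemma unlinkedTriplesExhaust_endpoints (G : SimpleGraph V) :
    UnlinkedTriplesExhaust (endpoints G) := by
  intro m n k htriple x hx
  obtain ⟨a, w, heven, hpos, rfl, rfl⟩ :=
    exists_walk_of_not_linked htriple.map_eq₁₂ htriple.unlinked₁₂
  have hw : IsUnlinkedTripleWalk k w := ⟨heven, htriple⟩
  obtain ⟨s, y, t, y', hsy, p, q, r, hst, hyy', hstk, hp, hq, hr, hpair⟩ := hw.exists_crossing hpos
  have hcases := (hw.of_walkPair_eq hpair).eq_of_crossing hp hq hst hstk hyy' hr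
    (hx.trans htriple.map_eq₁₃)
  rcases Sym2.eq_iff.1 hpair with ⟨h₁, h₂⟩ | ⟨h₁, h₂⟩ <;> rw [← h₁, ← h₂] at hcases <;> tauto

end ThreeMonomials

end ToricGraph

theorem theorem3p14_general {V K : Type*} [DecidableEq V] [Field K] (G : SimpleGraph V)
    [Fintype G.edgeSet] (hsharp : ToricGraph.SatisfiesSharp G)
    (hmin : ¬ ∃ (a : V) (w : G.Walk a a), Even w.length ∧
      ToricGraph.IsMinimalBinomial (ToricGraph.toricIdeal K (ToricGraph.edgeVectors G))
        (ToricGraph.walkBinomial K w) ∧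
      ToricGraph.IsCircuit (ToricGraph.edgeVectors G) (ToricGraph.walkBinomial K w) ∧
      ToricGraph.IsSquarefreeExp (ToricGraph.walkPlus w) ∧
      ToricGraph.IsSquarefreeExp (ToricGraph.walkMinus w) ∧
      ¬ ToricGraph.IsIndispensableMonomial (ToricGraph.toricIdeal K (ToricGraph.edgeVectors G))
        (ToricGraph.walkPlus w) ∧
      ¬ ToricGraph.IsIndispensableMonomial (ToricGraph.toricIdeal K (ToricGraph.edgeVectors G))
        (ToricGraph.walkMinus w)) :
    ToricGraph.bar (ToricGraph.toricIdeal K (ToricGraph.edgeVectors G)) =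
      ToricGraph.mu (ToricGraph.toricIdeal K (ToricGraph.edgeVectors G)) := by
  rw [ToricGraph.toricIdeal_edgeVectors_eq_fiberIdeal] at hmin ⊢
  have hdeg := ToricGraph.preservesDegree_endpoints G
  refine ToricGraph.bar_fiberIdeal_eq_mu hdeg hsharp.squarefreeOrSplit
    (ToricGraph.unlinkedTriplesExhaust_endpoints G) fun m n hD hunlinked hminimal => ?_
  have hpair := ToricGraph.isCircuitPair_of_not_linked hsharp hD hunlinked
  have hplus := hpair.isSquarefreeExp
  have hminus := hpair.symm.isSquarefreeExp
  obtain ⟨a, w, hw, rfl, rfl⟩ := hpair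
  have hne : ToricGraph.walkPlus w ≠ ToricGraph.walkMinus w := fun h => hunlinked (h ▸ .refl _)
  by_contra! hisolated
  exact hmin ⟨a, w, hw.even, hminimal, hw.isCircuit K, hplus, hminus,
    fun h => hisolated.1 (h.isIsolated hdeg hplus hD.symm hne.symm),
    fun h => hisolated.2 (h.isIsolated hdeg hminus hD hne)⟩

theorem theorem3p14 {V K : Type*} [Fintype V] [DecidableEq V] [Field K]
    (G : SimpleGraph V) [DecidableRel G.Adj] (hconn : G.Connected)
    (hsharp : ToricGraph.SatisfiesSharp G)
    (hmin : ¬ ∃ (a : V) (w : G.Walk a a), Even w.length ∧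
      ToricGraph.IsMinimalBinomial (ToricGraph.graphIdeal K G) (ToricGraph.walkBinomial K w) ∧
      ToricGraph.IsCircuit (ToricGraph.edgeVectors G) (ToricGraph.walkBinomial K w) ∧
      ToricGraph.IsSquarefreeExp (ToricGraph.walkPlus w) ∧
      ToricGraph.IsSquarefreeExp (ToricGraph.walkMinus w) ∧
      ¬ ToricGraph.IsIndispensableMonomial (ToricGraph.graphIdeal K G) (ToricGraph.walkPlus w) ∧
      ¬ ToricGraph.IsIndispensableMonomial (ToricGraph.graphIdeal K G)
        (ToricGraph.walkMinus w)) :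
    ToricGraph.bar (ToricGraph.graphIdeal K G) = ToricGraph.mu (ToricGraph.graphIdeal K G) :=
  theorem3p14_general G hsharp hmin
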